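/- Let $n\ge 1$, $\alpha\in\mathbb N$, $\beta\in\mathbb Z$ with $\alpha\ge\beta$. Let $U=\mathbb C^2$ with basis $x,y$, $V=S^{2n+1}U$ (binary forms of degree $2n+1$), and let $\mathbb C^*$ act on $U$ by $\sigma_1(t)=\mathrm{diag}(t^\alpha,t^\beta)$, hence on $V$ and on $\bigwedge^2V$. The symplectic form $\langle x^iy^{2n+1-i},x^jy^{2n+1-j}\rangle=(-1)^i\,i!\,j!$ if $i+j=2n+1$, and $0$ otherwise, induces on $\bigwedge^2V$ the nondegenerate symmetric form $\langle a\wedge b,c\wedge d\rangle=\langle a,c\rangle\langle b,d\rangle-\langle a,d\rangle\langle b,c\rangle$. Through it $f\in\bigwedge^2V$ is identified with the linear form $\langle f,\cdot\rangle$ on $\bigwedge^2V$, i.e. with the skew form $(u,v)\mapsto\langle f,u\wedge v\rangle$ on $V$. Let $\mathbb P=\mathbb P(V)$ be the projective space of lines of $V$ and let $g:\mathcal O(-1)\to V\otimes\mathcal O$ be the tautological inclusion, $Q=\operatorname{coker}g$. For $f\in\bigwedge^2V$ let $N(f)=\ker({}^Tg\circ f:Q\to\mathcal O(1))$. For $W\subset\bigwedge^2V$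 let $F(W)$ be defined by $Q(-1)\xrightarrow{\varpi_W}(\bigwedge^2V/W)\otimes\mathcal O\to F(W)(1)\to0$, where $\varpi_W$ is induced by $s\mapsto v\wedge s \bmod W$ at the point $\mathbb Cv$. Let $\mathcal W$ be the set of $\mathbb C^*$-invariant subspaces $W\subset\bigwedge^2V$ with $\dim W=\binom{2n+2}{2}-4n-1$ which contain no nonzero decomposable element $u\wedge v$. Let $W\in\mathcal W$, and call $f\in\bigwedge^2V$ adapted to $W$ if it is nondegenerate as a skew form on $V$, semi-invariant (for every $t\in\mathbb C^*$ there is $a\in\mathbb C^*$ with ${}^T\sigma_1(t)f\sigma_1(t)=af$), and $\langle f,w\rangle=0$ for all $w\in W$. Then: 1. There is an $f$ adapted to $W$. 2. If $\alpha>\beta$, it is unique up to a nonzero scalar, and its matrix in the basis $x^{2n+1-j}y^j$ ($0\le j\le 2n+1$) is antidiagonal with nonzero antidiagonal entries (so $N(f)$ is a special null-correlation bundle). 3. For every $f$ adapted to $W$ there is a $\mathbb C^*$-invariant subspace $D_W\subset\bigwedge^2V$ with $\bigwedge^2V=D_W\oplus W$ and an exact sequence of sheaves of $\mathcal O_{\mathbb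 P}$-modules $$0\to N(f)(-1)\to (D_W\cap\ker\langle f,\cdot\rangle)\otimes\mathcal O_{\mathbb P}\to F(W)(1)\to0 .$$ If $f\notin W$, one can moreover choose $D_W$ to contain $f$, and then there is an exact sequence $$0\to N(f)(-1)\to (D_W/\mathbb Cf)\otimes\mathcal O_{\mathbb P}\to F(W)(1)\to0 .$$ -/

import Mathlib

open CategoryTheory Opposite TopologicalSpace
open scoped LinearAlgebra.Projectivization

noncomputable section

namespace ProjBundle

section Regular

variable (V : Type) [AddCommGroup V] [Module ℂ V]

/-- The algebra of polynomial functions on `V`, generated by the linear forms. -/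
def polyFun : Subalgebra ℂ (V → ℂ) :=
  Algebra.adjoin ℂ (Set.range fun (φ : Module.Dual ℂ V) (v : V) => φ v)

variable {V}
variable {E : Type} [AddCommGroup E] [Module ℂ E]

/-- `p : V → E` is a homogeneous polynomial map of degree `k` (for `E` finite-dimensional). -/
def IsForm (k : ℕ) (p : V → E) : Prop :=
  (∀ φ : Module.Dual ℂ E, (fun v => φ (p v)) ∈ polyFun V) ∧
    ∀ (c : ℂ) (v : V), p (c • v) = c ^ k • p v

variable (V) in
/-- The Zariski topology on the set `ℙ ℂ V` of lines of `V`: the sets `{q ≠ 0}`, for `q` a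
homogeneous polynomial function, form a basis. -/
@[reducible]
def zariski : TopologicalSpace (ℙ ℂ V) :=
  TopologicalSpace.generateFrom
    {D | ∃ (k : ℕ) (q : V → ℂ), IsForm k q ∧ D = {x : ℙ ℂ V | q x.rep ≠ 0}}

variable (V) in
/-- The projective space of lines of `V`, with its Zariski topology. -/
def projSpace : TopCat := @TopCat.of (ℙ ℂ V) (zariski V)

/-- The point `ℂ v` of the projective space. -/
def pt (v : V) (h : v ≠ 0) : projSpace V := Projectivization.mk ℂ v h

/-- The punctured cone over `U`: the nonzero vectors whose line belongs to `U`. -/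
def cone (U : Opens (projSpace V)) : Set V := {v | ∃ h : v ≠ 0, pt v h ∈ U}

lemma cone_mono {U U' : Opens (projSpace V)} (h : U' ≤ U) : cone U' ⊆ cone U :=
  fun _ ⟨h0, h1⟩ => ⟨h0, h h1⟩

/-- `s` is a regular section of `E ⊗ 𝒪(d)` over `U`: a function on the cone over `U` which is,
locally on `U`, a quotient `p / q` of homogeneous polynomial maps with `deg p - deg q = d`. -/
def IsRegular (d : ℤ) (U : Opens (projSpace V)) (s : cone U → E) : Prop :=
  ∀ x ∈ U, ∃ (U' : Opens (projSpace V)) (_ : x ∈ U') (hU : U' ≤ U) (k l : ℕ)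
    (p : V → E) (q : V → ℂ), (k : ℤ) = l + d ∧ IsForm k p ∧ IsForm l q ∧
      ∀ (v : V) (hv : v ∈ cone U'), q v ≠ 0 ∧ s ⟨v, cone_mono hU hv⟩ = (q v)⁻¹ • p v

lemma IsForm.smul {k l : ℕ} {p : V → E} {q : V → ℂ} (hp : IsForm k p) (hq : IsForm l q) :
    IsForm (k + l) (fun v => q v • p v) := by
  refine ⟨fun φ => ?_, fun c v => ?_⟩
  · have h := mul_mem (hq.1 LinearMap.id) (hp.1 φ)
    convert h using 1
    ext v; simp
  · simp only [hp.2, hq.2, smul_smul, smul_eq_mul]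
    ring_nf

lemma IsForm.add {k : ℕ} {p p' : V → E} (hp : IsForm k p) (hp' : IsForm k p') :
    IsForm k (fun v => p v + p' v) := by
  refine ⟨fun φ => ?_, fun c v => ?_⟩
  · have h := add_mem (hp.1 φ) (hp'.1 φ)
    convert h using 1
    ext v; simp
  · simp only [hp.2, hp'.2, smul_add]

lemma isForm_const (e : E) : IsForm 0 (fun _ : V => e) := by
  refine ⟨fun φ => ?_, fun c v => by simp⟩
  exact (polyFun V).algebraMap_mem (φ e)

lemma isForm_zero (k : ℕ) : IsForm k (fun _ : V => (0 : E)) := by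
  refine ⟨fun φ => ?_, fun c v => by simp⟩
  have h : (fun _ : V => φ 0) = 0 := by ext; simp
  exact h ▸ (polyFun V).zero_mem

lemma IsForm.linear {E' : Type} [AddCommGroup E'] [Module ℂ E'] [FiniteDimensional ℂ E]
    {k : ℕ} {p : V → E} (hp : IsForm k p) (L : V →ₗ[ℂ] E →ₗ[ℂ] E') :
    IsForm (k + 1) (fun v => L v (p v)) := by
  refine ⟨fun φ => ?_, fun c v => ?_⟩
  · let b := Module.finBasis ℂ E
    have h : (fun v => φ (L v (p v))) =
        ∑ i, ((fun v => φ (L v (b i))) * fun v => b.coord i (p v)) := by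
      ext v
      have h := congr_arg (fun e => φ (L v e)) (b.sum_repr (p v)).symm
      refine h.trans ?_
      simp [-Module.Basis.sum_repr, mul_comm]
    rw [h]
    refine sum_mem fun i _ => mul_mem ?_ (hp.1 _)
    exact Algebra.subset_adjoin ⟨φ ∘ₗ L.flip (b i), rfl⟩
  · simp only [hp.2, map_smul, LinearMap.smul_apply, smul_smul, pow_succ]

lemma IsRegular.add {d : ℤ} {U : Opens (projSpace V)} {s s' : cone U → E}
    (h : IsRegular d U s) (h' : IsRegular d U s') : IsRegular d U (s + s') := by
  intro x hx
  obtain ⟨U₁, hx₁, hU₁, k, l, p, q, hkl, hp, hq, e⟩ := h x hx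
  obtain ⟨U₂, hx₂, hU₂, k', l', p', q', hkl', hp', hq', e'⟩ := h' x hx
  refine ⟨U₁ ⊓ U₂, ⟨hx₁, hx₂⟩, inf_le_left.trans hU₁, k + l', l + l',
    fun v => q' v • p v + q v • p' v, fun v => q' v • q v, by push_cast; omega,
    (hp.smul hq').add ?_, hq.smul hq', fun v hv => ?_⟩
  · have : k + l' = k' + l := by omega
    rw [this]; exact hp'.smul hq
  · obtain ⟨a, b⟩ := e v (cone_mono inf_le_left hv)
    obtain ⟨a', b'⟩ := e' v (cone_mono inf_le_right hv)
    refine ⟨mul_ne_zero a' a, ?_⟩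
    simp only [Pi.add_apply, b, b', smul_add, smul_smul, smul_eq_mul]
    congr 2 <;> field_simp

lemma IsRegular.smul {d d' d'' : ℤ} (hd : d'' = d' + d) {U : Opens (projSpace V)}
    {s : cone U → E} {r : cone U → ℂ}
    (h : IsRegular d U s) (h' : IsRegular d' U r) : IsRegular d'' U (fun v => r v • s v) := by
  intro x hx
  obtain ⟨U₁, hx₁, hU₁, k, l, p, q, hkl, hp, hq, e⟩ := h x hx
  obtain ⟨U₂, hx₂, hU₂, k', l', p', q', hkl', hp', hq', e'⟩ := h' x hx
  refine ⟨U₁ ⊓ U₂, ⟨hx₁, hx₂⟩, inf_le_left.trans hU₁, k + k', l + l',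
    fun v => p' v • p v, fun v => q' v • q v, by push_cast; omega,
    hp.smul hp', hq.smul hq', fun v hv => ?_⟩
  obtain ⟨a, b⟩ := e v (cone_mono inf_le_left hv)
  obtain ⟨a', b'⟩ := e' v (cone_mono inf_le_right hv)
  refine ⟨mul_ne_zero a' a, ?_⟩
  simp only [b, b', smul_smul, smul_eq_mul]
  congr 1; field_simp

lemma IsRegular.zero (d : ℤ) (U : Opens (projSpace V)) :
    IsRegular d U (0 : cone U → E) := by
  intro x hx
  obtain ⟨y, hy⟩ : ∃ y : ℙ ℂ V, y = x := ⟨x, rfl⟩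
  obtain ⟨φ, hφ⟩ : ∃ φ : Module.Dual ℂ V, φ y.rep ≠ 0 := by
    by_contra! h
    exact y.rep_nonzero ((Module.forall_dual_apply_eq_zero_iff ℂ _).1 h)
  have hform : ∀ l : ℕ, IsForm l (fun v => φ v ^ l) := fun l => by
    refine ⟨fun ψ => ?_, fun c v => by simp [mul_pow]⟩
    have : (fun v => ψ (φ v ^ l)) = ψ 1 • (fun v => φ v) ^ l := by
      ext v
      have := ψ.map_smul (φ v ^ l) 1
      simp only [smul_eq_mul, mul_one] at this
      simp [this, mul_comm]
    have hm : (fun v => φ v) ∈ polyFun V := Algebra.subset_adjoin ⟨φ, rfl⟩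
    rw [this]
    exact Subalgebra.smul_mem _ (pow_mem hm l) _
  let D : Set (ℙ ℂ V) := {x | φ x.rep ^ (-d).toNat ≠ 0}
  have hD : @IsOpen _ (zariski V) D :=
    TopologicalSpace.GenerateOpen.basic D
      (Exists.intro _ (Exists.intro _ (And.intro (hform (-d).toNat) rfl)))
  let D' : Opens (projSpace V) := ⟨D, hD⟩
  refine ⟨U ⊓ D', (⟨hx, ?_⟩ : x ∈ U ∧ x ∈ D), inf_le_left, d.toNat, (-d).toNat, 0,
    fun v => φ v ^ (-d).toNat,
    by omega, isForm_zero _, hform _, fun v hv => ?_⟩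
  · subst hy; exact pow_ne_zero _ hφ
  · obtain ⟨h0, -, h1⟩ := hv
    refine ⟨?_, by simp⟩
    obtain ⟨a, ha⟩ := Projectivization.exists_smul_eq_mk_rep ℂ v h0
    have h2 : φ (Projectivization.mk ℂ v h0).rep ^ (-d).toNat ≠ 0 := h1
    rw [← ha, Units.smul_def, map_smul, smul_eq_mul, mul_pow] at h2
    exact right_ne_zero_of_mul h2

lemma IsRegular.const (U : Opens (projSpace V)) (e : E) :
    IsRegular 0 U (fun _ => e) := fun x hx =>
  ⟨U, hx, le_rfl, 0, 0, _, _, by simp, isForm_const e, isForm_const 1, fun v hv => by simp⟩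

lemma IsRegular.neg {d : ℤ} {U : Opens (projSpace V)} {s : cone U → E}
    (h : IsRegular d U s) : IsRegular d U (-s) := by
  have := IsRegular.smul (d'' := d) (by simp) h (IsRegular.const U (-1 : ℂ))
  convert this using 1
  ext v; simp

lemma IsRegular.linear {E' : Type} [AddCommGroup E'] [Module ℂ E'] [FiniteDimensional ℂ E]
    (L : V →ₗ[ℂ] E →ₗ[ℂ] E') {d d' : ℤ} (hd : d' = d + 1) {U : Opens (projSpace V)}
    {s : cone U → E} (h : IsRegular d U s) : IsRegular d' U (fun v => L v (s v)) := by
  intro x hx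
  obtain ⟨U₁, hx₁, hU₁, k, l, p, q, hkl, hp, hq, e⟩ := h x hx
  refine ⟨U₁, hx₁, hU₁, k + 1, l, _, q, by push_cast; omega, hp.linear L, hq, fun v hv => ?_⟩
  obtain ⟨a, b⟩ := e v hv
  exact ⟨a, by simp [b]⟩

/-- Restriction of functions from the cone over `U` to the cone over `U'`. -/
def res {U U' : Opens (projSpace V)} (h : U' ≤ U) (s : cone U → E) : cone U' → E :=
  fun v => s ⟨v, cone_mono h v.2⟩

lemma IsRegular.res {d : ℤ} {U U' : Opens (projSpace V)} (h : U' ≤ U) {s : cone U → E}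
    (hs : IsRegular d U s) : IsRegular d U' (res h s) := by
  intro x hx
  obtain ⟨U₁, hx₁, hU₁, k, l, p, q, hkl, hp, hq, e⟩ := hs x (h hx)
  exact ⟨U₁ ⊓ U', ⟨hx₁, hx⟩, inf_le_right, k, l, p, q, hkl, hp, hq,
    fun v hv => e v (cone_mono inf_le_left hv)⟩

lemma IsRegular.glue {d : ℤ} {ι : Type} (U : ι → Opens (projSpace V))
    (sf : ∀ i, cone (U i) → E) (hs : ∀ i, IsRegular d (U i) (sf i))
    (hc : ∀ i j (v : V) (hi : v ∈ cone (U i)) (hj : v ∈ cone (U j)),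
      sf i ⟨v, hi⟩ = sf j ⟨v, hj⟩) :
    ∃ s : cone (iSup U) → E, IsRegular d (iSup U) s ∧
      ∀ i (v : V) (hi : v ∈ cone (U i)), s ⟨v, cone_mono (le_iSup U i) hi⟩ = sf i ⟨v, hi⟩ := by
  have hex : ∀ v : cone (iSup U), ∃ i, v.1 ∈ cone (U i) := by
    rintro ⟨v, h0, h1⟩
    obtain ⟨i, hi⟩ := Opens.mem_iSup.1 h1
    exact ⟨i, h0, hi⟩
  choose idx hidx using hex
  have key : ∀ i (v : V) (hi : v ∈ cone (U i)),
      sf (idx ⟨v, cone_mono (le_iSup U i) hi⟩) ⟨v, hidx _⟩ = sf i ⟨v, hi⟩ :=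
    fun i v hi => hc _ _ _ _ _
  refine ⟨fun v => sf (idx v) ⟨v, hidx v⟩, fun x hx => ?_, key⟩
  obtain ⟨i, hi⟩ := Opens.mem_iSup.1 hx
  obtain ⟨U₁, hx₁, hU₁, k, l, p, q, hkl, hp, hq, e⟩ := hs i x hi
  refine ⟨U₁, hx₁, hU₁.trans (le_iSup U i), k, l, p, q, hkl, hp, hq, fun v hv => ⟨(e v hv).1, ?_⟩⟩
  rw [← (e v hv).2]
  exact key i v (cone_mono hU₁ hv)

end Regular

section Sheaves

variable (V : Type) [AddCommGroup V] [Module ℂ V]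
variable (E : Type) [AddCommGroup E] [Module ℂ E]

/-- The ring of regular functions on `U`. -/
def regFun (U : Opens (projSpace V)) : Subring (cone U → ℂ) where
  carrier := {s | IsRegular 0 U s}
  mul_mem' h h' := IsRegular.smul (by simp) h' h
  one_mem' := IsRegular.const U 1
  add_mem' h h' := h.add h'
  zero_mem' := IsRegular.zero 0 U
  neg_mem' h := h.neg

/-- The group of sections of `E ⊗ 𝒪(d)` over `U`. -/
def regSec (d : ℤ) (U : Opens (projSpace V)) : AddSubgroup (cone U → E) where
  carrier := {s | IsRegular d U s}
  add_mem' h h' := h.add h'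
  zero_mem' := IsRegular.zero d U
  neg_mem' h := h.neg

instance (d : ℤ) (U : Opens (projSpace V)) : Module (regFun V U) (regSec V E d U) where
  smul r s := ⟨fun v => r.1 v • s.1 v, IsRegular.smul (by simp) s.2 r.2⟩
  one_smul s := Subtype.ext (funext fun v => one_smul ℂ (s.1 v))
  mul_smul r r' s := Subtype.ext (funext fun v => mul_smul (r.1 v) (r'.1 v) (s.1 v))
  smul_zero r := Subtype.ext (funext fun v => smul_zero (r.1 v))
  smul_add r s s' := Subtype.ext (funext fun v => smul_add (r.1 v) (s.1 v) (s'.1 v))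
  add_smul r r' s := Subtype.ext (funext fun v => add_smul (r.1 v) (r'.1 v) (s.1 v))
  zero_smul s := Subtype.ext (funext fun v => zero_smul ℂ (s.1 v))

/-- The presheaf of regular functions. -/
def structurePresheaf : TopCat.Presheaf CommRingCat.{0} (projSpace V) where
  obj U := CommRingCat.of (regFun V U.unop)
  map f := CommRingCat.ofHom
    { toFun := fun s => ⟨res f.unop.le s.1, s.2.res f.unop.le⟩
      map_one' := rfl
      map_mul' := fun _ _ => rfl
      map_zero' := rfl
      map_add' := fun _ _ => rfl }

/-- The presheaf of abelian groups underlying `E ⊗ 𝒪(d)`. -/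
def secPresheaf (d : ℤ) : TopCat.Presheaf AddCommGrpCat.{0} (projSpace V) where
  obj U := AddCommGrpCat.of (regSec V E d U.unop)
  map f := AddCommGrpCat.ofHom
    { toFun := fun s => ⟨res f.unop.le s.1, s.2.res f.unop.le⟩
      map_zero' := rfl
      map_add' := fun _ _ => rfl }

lemma structurePresheaf_isSheaf : (structurePresheaf V).IsSheaf := by
  rw [TopCat.Presheaf.isSheaf_iff_isSheafUniqueGluing]
  intro ι U sf hc
  obtain ⟨s, hs, hsf⟩ := IsRegular.glue (d := 0) U (fun i => (sf i).1) (fun i => (sf i).2)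
    (fun i j v hi hj => congr_fun (congr_arg Subtype.val (hc i j))
      ⟨v, hi.1, show _ ∈ U i ⊓ U j from ⟨hi.2, hj.2⟩⟩)
  refine ⟨⟨s, hs⟩, fun i => Subtype.ext (funext fun v => hsf i v v.2), fun t ht => ?_⟩
  refine Subtype.ext (funext fun v => ?_)
  obtain ⟨i, hi⟩ := Opens.mem_iSup.1 v.2.2
  have h1 := congr_fun (congr_arg Subtype.val (ht i)) ⟨v.1, v.2.1, hi⟩
  have h2 := hsf i v.1 ⟨v.2.1, hi⟩
  exact h1.trans h2.symm

lemma secPresheaf_isSheaf (d : ℤ) : (secPresheaf V E d).IsSheaf := by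
  rw [TopCat.Presheaf.isSheaf_iff_isSheafUniqueGluing]
  intro ι U sf hc
  obtain ⟨s, hs, hsf⟩ := IsRegular.glue (d := d) U (fun i => (sf i).1) (fun i => (sf i).2)
    (fun i j v hi hj => congr_fun (congr_arg Subtype.val (hc i j))
      ⟨v, hi.1, show _ ∈ U i ⊓ U j from ⟨hi.2, hj.2⟩⟩)
  refine ⟨⟨s, hs⟩, fun i => Subtype.ext (funext fun v => hsf i v v.2), fun t ht => ?_⟩
  refine Subtype.ext (funext fun v => ?_)
  obtain ⟨i, hi⟩ := Opens.mem_iSup.1 v.2.2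
  have h1 := congr_fun (congr_arg Subtype.val (ht i)) ⟨v.1, v.2.1, hi⟩
  have h2 := hsf i v.1 ⟨v.2.1, hi⟩
  exact h1.trans h2.symm

/-- The structure sheaf `𝒪` of the projective space, as a sheaf of rings. -/
def structureSheaf : Sheaf (Opens.grothendieckTopology (projSpace V)) RingCat.{0} :=
  (sheafCompose _ (forget₂ CommRingCat.{0} RingCat.{0})).obj
    ⟨structurePresheaf V, structurePresheaf_isSheaf V⟩

/-- The abelian category of sheaves of `𝒪`-modules on the projective space. -/
abbrev Mod := SheafOfModules.{0} (structureSheaf V)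

instance (d : ℤ) (U : (Opens (projSpace V))ᵒᵖ) :
    Module ((structureSheaf V).obj.obj U) ((secPresheaf V E d).obj U) :=
  inferInstanceAs (Module (regFun V U.unop) (regSec V E d U.unop))

/-- The sheaf of `𝒪`-modules `E ⊗ 𝒪(d)`. -/
def twisted (d : ℤ) : Mod V where
  val := PresheafOfModules.ofPresheaf (R := (structureSheaf V).obj) (secPresheaf V E d)
    (fun {_ _} _ _ _ => rfl)
  isSheaf := secPresheaf_isSheaf V E d

variable {V E}

/-- A linear map `L : V → Hom(E, E')` defines the morphism `E ⊗ 𝒪(d) ⟶ E' ⊗ 𝒪(d + 1)` sending a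
section `s` to `v ↦ L v (s v)`. -/
def linMap {E' : Type} [AddCommGroup E'] [Module ℂ E'] [FiniteDimensional ℂ E]
    (L : V →ₗ[ℂ] E →ₗ[ℂ] E') (d d' : ℤ) (hd : d' = d + 1) : twisted V E d ⟶ twisted V E' d' where
  val := PresheafOfModules.homMk
    { app := fun U => AddCommGrpCat.ofHom
        { toFun := fun s : regSec V E d U.unop =>
            (⟨fun v => L v (s.1 v), s.2.linear L hd⟩ : regSec V E' d' U.unop)
          map_zero' := Subtype.ext (funext fun v => map_zero (L v))
          map_add' := fun s s' => Subtype.ext (funext fun v => map_add (L v) (s.1 v) (s'.1 v)) }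
      naturality := fun _ _ _ => rfl }
    (fun U (r : regFun V U.unop) (s : regSec V E d U.unop) =>
      Subtype.ext (funext fun v => map_smul (L v) (r.1 v) (s.1 v)))


variable (V) in
/-- Presheaves of `𝒪`-modules; the tensor product is computed on each open set. -/
abbrev PreMod := PresheafOfModules.{0} (structurePresheaf V ⋙ forget₂ CommRingCat.{0} RingCat.{0})

variable (V) in
/-- The presheaf tensor product with `𝒪(-1)`. -/
def preTwist : PresheafOfModules.{0} (structureSheaf V).obj ⥤
    PresheafOfModules.{0} (structureSheaf V).obj :=
  MonoidalCategory.tensorRight (C := PreMod V) (twisted V ℂ (-1)).val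

variable (V) in
/-- The twist `ℱ ↦ ℱ(-1) = ℱ ⊗ 𝒪(-1)`: the sheaf associated to the presheaf tensor product. -/
def twist : Mod V ⥤ Mod V :=
  SheafOfModules.forget (structureSheaf V) ⋙ preTwist V ⋙
    PresheafOfModules.sheafification (𝟙 (structureSheaf V).obj)

variable (V E) in
/-- The map `s ⊗ r ↦ r s` on the sections over `U` of `E ⊗ 𝒪(1)` and `𝒪(-1)`. -/
def contrApp (U : Opens (projSpace V)) :
    TensorProduct (regFun V U) (regSec V E 1 U) (regSec V ℂ (-1) U) →ₗ[regFun V U]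
      regSec V E 0 U :=
  TensorProduct.lift (LinearMap.mk₂ (regFun V U)
    (fun s r => (⟨fun v => r.1 v • s.1 v, IsRegular.smul (by simp) s.2 r.2⟩ : regSec V E 0 U))
    (fun s s' r => Subtype.ext (funext fun v => smul_add (r.1 v) (s.1 v) (s'.1 v)))
    (fun a s r => Subtype.ext (funext fun v => smul_comm (r.1 v) (a.1 v) (s.1 v)))
    (fun s r r' => Subtype.ext (funext fun v => add_smul (r.1 v) (r'.1 v) (s.1 v)))
    (fun a s r => Subtype.ext (funext fun v => mul_smul (a.1 v) (r.1 v) (s.1 v))))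

variable (V E) in
/-- The multiplication morphism on the presheaf tensor product of `E ⊗ 𝒪(1)` and `𝒪(-1)`. -/
def contrPre : (preTwist V).obj (twisted V E 1).val ⟶ (twisted V E 0).val where
  app U := (ModuleCat.ofHom (contrApp V E U.unop) :
    ModuleCat.of (regFun V U.unop) _ ⟶ ModuleCat.of (regFun V U.unop) _)
  naturality {U U'} f := by
    refine ModuleCat.MonoidalCategory.tensor_ext (R := (structurePresheaf V).obj U)
      (M₁ := (twisted V E 1).val.obj U) (M₂ := (twisted V ℂ (-1)).val.obj U) fun s r => ?_
    rfl

variable (V E) in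
/-- The multiplication morphism `(E ⊗ 𝒪(1)) ⊗ 𝒪(-1) ⟶ E ⊗ 𝒪`. -/
def contr : (twist V).obj (twisted V E 1) ⟶ twisted V E 0 :=
  ((PresheafOfModules.sheafificationAdjunction (𝟙 (structureSheaf V).obj)).homEquiv _ _).symm
    (contrPre V E)

end Sheaves

section Bundles

variable (V : Type) [AddCommGroup V] [Module ℂ V]

lemma upd {X : Type} (u w v : X) : Function.update ![u, w] 1 v = ![u, v] := by
  ext i; fin_cases i <;> rfl

/-- The bilinear map `(u, v) ↦ u ∧ v`. -/
def wedge : V →ₗ[ℂ] V →ₗ[ℂ] ⋀[ℂ]^2 V :=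
  LinearMap.mk₂ ℂ (fun u v => exteriorPower.ιMulti ℂ 2 ![u, v])
    (fun u u' v => (exteriorPower.ιMulti ℂ 2).map_vecCons_add ![v] u u')
    (fun c u v => (exteriorPower.ιMulti ℂ 2).map_vecCons_smul ![v] c u)
    (fun u v v' => by
      have h := (exteriorPower.ιMulti ℂ 2 (M := V)).map_update_add ![u, 0] 1 v v'
      rwa [upd, upd, upd] at h)
    (fun c u v => by
      have h := (exteriorPower.ιMulti ℂ 2 (M := V)).map_update_smul ![u, 0] 1 c v
      rwa [upd, upd] at h)

lemma wedge_self (v : V) : wedge V v v = 0 :=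
  (exteriorPower.ιMulti ℂ 2 (M := V)).map_eq_zero_of_eq ![v, v] (i := 0) (j := 1) rfl (by decide)

variable [FiniteDimensional ℂ V]

/-- The tautological inclusion `g : 𝒪(-1) ⟶ V ⊗ 𝒪`. -/
def taut : twisted V ℂ (-1) ⟶ twisted V V 0 :=
  linMap (LinearMap.lsmul ℂ V).flip (-1) 0 (by norm_num)

/-- The quotient bundle `Q`, with `0 ⟶ 𝒪(-1) ⟶ V ⊗ 𝒪 ⟶ Q ⟶ 0`. -/
def quotBundle : Mod V := Limits.cokernel (taut V)

variable {V}

/-- A morphism `V ⊗ 𝒪 ⟶ E ⊗ 𝒪(1)`, given on the fibre at `ℂ v` by `s ↦ L v s`, with `L v v = 0`,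
factors through `Q`. -/
def quotDesc {E : Type} [AddCommGroup E] [Module ℂ E] (L : V →ₗ[ℂ] V →ₗ[ℂ] E)
    (hL : ∀ v, L v v = 0) : quotBundle V ⟶ twisted V E 1 :=
  Limits.cokernel.desc (taut V) (linMap L 0 1 (by norm_num)) (by
    apply SheafOfModules.hom_ext
    ext U s
    refine Subtype.ext (funext fun v => ?_)
    exact ((L v).map_smul _ _).trans (by rw [hL]; exact smul_zero _))

/-- The morphism `ᵀg ∘ f : Q ⟶ 𝒪(1)` defined by a skew form `ω` on `V`, seen as a linear form on
`⋀² V`; at the point `ℂ v` it is `s ↦ ω (s ∧ v)`. -/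
def formMap (ω : Module.Dual ℂ (⋀[ℂ]^2 V)) : quotBundle V ⟶ twisted V ℂ 1 :=
  quotDesc ((wedge V).flip.compr₂ ω) (fun v => by simp [wedge_self])

/-- The null-correlation bundle `N(f)`, with `0 ⟶ N(f) ⟶ Q ⟶ 𝒪(1)`. -/
def nullCorr (ω : Module.Dual ℂ (⋀[ℂ]^2 V)) : Mod V := Limits.kernel (formMap ω)

/-- The morphism `ϖ_W : Q(-1) ⟶ (⋀² V / W) ⊗ 𝒪`: the `(-1)`-twist of the morphism
`Q ⟶ (⋀² V / W) ⊗ 𝒪(1)` given at the point `ℂ v` by `s ↦ v ∧ s mod W`. -/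
def tangoMap (W : Submodule ℂ (⋀[ℂ]^2 V)) :
    (twist V).obj (quotBundle V) ⟶ twisted V (⋀[ℂ]^2 V ⧸ W) 0 :=
  (twist V).map (quotDesc ((wedge V).compr₂ W.mkQ) (fun v => by simp [wedge_self])) ≫ contr V _

/-- The bundle `F(W)(1)`, where `F(W)` is the Tango bundle of `W`; it is the cokernel of `ϖ_W`. -/
def tangoOne (W : Submodule ℂ (⋀[ℂ]^2 V)) : Mod V := Limits.cokernel (tangoMap W)

/-- There is an exact sequence `0 ⟶ N(f)(-1) ⟶ E ⊗ 𝒪 ⟶ F(W)(1) ⟶ 0`. -/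
def HasExactSeq (ω : Module.Dual ℂ (⋀[ℂ]^2 V)) (E : Type) [AddCommGroup E] [Module ℂ E]
    (W : Submodule ℂ (⋀[ℂ]^2 V)) : Prop :=
  ∃ (i : (twist V).obj (nullCorr ω) ⟶ twisted V E 0) (p : twisted V E 0 ⟶ tangoOne W)
    (h : i ≫ p = 0), (ShortComplex.mk i p h).ShortExact

end Bundles

/-- The quotient `D / ℂ f` of a subspace `D` by the line spanned by `f ∈ D`. -/
abbrev modLine {M : Type} [AddCommGroup M] [Module ℂ M] (D : Submodule ℂ M) (f : M) : Type :=
  D ⧸ (Submodule.span ℂ {f}).comap D.subtype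

section BinaryForms

open MvPolynomial

/-- `S^{2n+1} U` for `U = ℂ²` with basis `x = X 0`, `y = X 1`: binary forms of degree `2n + 1`. -/
abbrev S (n : ℕ) : Type := homogeneousSubmodule (Fin 2) ℂ (2 * n + 1)

instance (n : ℕ) : FiniteDimensional ℂ (S n) :=
  Module.Finite.iff_fg.2 (homogeneousSubmodule_fg (Fin 2) ℂ (2 * n + 1))

/-- The basis vector `x^{2n+1-j} y^j`. -/
def mono (n : ℕ) (j : Fin (2 * n + 2)) : S n :=
  ⟨X 0 ^ (2 * n + 1 - (j : ℕ)) * X 1 ^ (j : ℕ), by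
    have h := ((isHomogeneous_X ℂ (0 : Fin 2)).pow (2 * n + 1 - (j : ℕ))).mul
      ((isHomogeneous_X ℂ (1 : Fin 2)).pow (j : ℕ))
    rw [mem_homogeneousSubmodule]
    convert h using 1
    omega⟩

/-- The action on `S^{2n+1} U` of the endomorphism `x ↦ a x`, `y ↦ b y` of `U`. -/
def diag (n : ℕ) (a b : ℂ) : S n →ₗ[ℂ] S n :=
  (aeval (R := ℂ) ![C a * X 0, C b * (X 1 : MvPolynomial (Fin 2) ℂ)]).toLinearMap.restrict
    (fun p hp => by
      rw [mem_homogeneousSubmodule] at hp ⊢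
      have h := hp.aeval ![C a * X 0, C b * (X 1 : MvPolynomial (Fin 2) ℂ)] (n := 1) (fun i => by
        fin_cases i
        · simpa using (isHomogeneous_C (Fin 2) a).mul (isHomogeneous_X ℂ (0 : Fin 2))
        · simpa using (isHomogeneous_C (Fin 2) b).mul (isHomogeneous_X ℂ (1 : Fin 2)))
      simpa using h)

/-- The action of `σ₁(t) = diag(t^α, t^β)` on `⋀² S^{2n+1} U`. -/
def act (n : ℕ) (α : ℕ) (β : ℤ) (t : ℂˣ) : ⋀[ℂ]^2 (S n) →ₗ[ℂ] ⋀[ℂ]^2 (S n) :=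
  exteriorPower.map 2 (diag n ((t ^ α : ℂˣ) : ℂ) ((t ^ β : ℂˣ) : ℂ))

/-- A subspace is `ℂ*`-invariant for the action of `σ₁`. -/
def IsInvariant {n : ℕ} (α : ℕ) (β : ℤ) (W : Submodule ℂ (⋀[ℂ]^2 (S n))) : Prop :=
  ∀ t : ℂˣ, W.map (act n α β t) ≤ W

/-- The coefficient of `x^i y^{2n+1-i}`. -/
def coef (n i : ℕ) : Module.Dual ℂ (S n) :=
  (lcoeff ℂ (Finsupp.single 0 i + Finsupp.single 1 (2 * n + 1 - i))).comp
    (homogeneousSubmodule (Fin 2) ℂ (2 * n + 1)).subtype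

/-- The symplectic form on `S^{2n+1} U`, with `⟨x^i y^{m-i}, x^j y^{m-j}⟩ = (-1)^i i! j!` if
`i + j = m` and `0` otherwise, where `m = 2n + 1`. -/
def symp (n : ℕ) : S n →ₗ[ℂ] Module.Dual ℂ (S n) :=
  ∑ i ∈ Finset.range (2 * n + 2),
    (coef n i).smulRight
      (((-1 : ℂ) ^ i * (i.factorial : ℂ) * ((2 * n + 1 - i).factorial : ℂ)) • coef n (2 * n + 1 - i))

/-- The symmetric form on `⋀² S^{2n+1} U` induced by the symplectic form of `S^{2n+1} U`:
`⟨a ∧ b, c ∧ d⟩ = ⟨a, c⟩ ⟨b, d⟩ - ⟨a, d⟩ ⟨b, c⟩`. The element `f` is identified with the linear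
form `⟨f, ·⟩`. -/
def pairing (n : ℕ) : ⋀[ℂ]^2 (S n) →ₗ[ℂ] Module.Dual ℂ (⋀[ℂ]^2 (S n)) :=
  (exteriorPower.pairingDual ℂ (S n) 2).comp (exteriorPower.map 2 (symp n))

/-- The `ℂ*`-invariant Tango subspaces `W` of `⋀² S^{2n+1} U`. -/
structure IsTango {n : ℕ} (α : ℕ) (β : ℤ) (W : Submodule ℂ (⋀[ℂ]^2 (S n))) : Prop where
  finrank_eq : Module.finrank ℂ W + (4 * n + 1) = (2 * n + 2).choose 2
  decomposable : ∀ u v : S n, wedge (S n) u v ∈ W → wedge (S n) u v = 0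
  invariant : IsInvariant α β W

/-- `f` is nondegenerate as a skew form on `S^{2n+1} U`, semi-invariant under `σ₁`, and orthogonal
to `W`. -/
structure IsAdapted {n : ℕ} (α : ℕ) (β : ℤ) (W : Submodule ℂ (⋀[ℂ]^2 (S n)))
    (f : ⋀[ℂ]^2 (S n)) : Prop where
  nondegenerate : ∀ u : S n, (∀ v : S n, pairing n f (wedge (S n) u v) = 0) → u = 0
  semiInvariant : ∀ t : ℂˣ, ∃ a : ℂˣ, (pairing n f).comp (act n α β t) = (a : ℂ) • pairing n f
  orthogonal : ∀ w ∈ W, pairing n f w = 0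

/-- The matrix of `f` in the basis `x^{2n+1-j} y^j` is antidiagonal with nonzero antidiagonal
entries: the associated null-correlation bundle is special. -/
def IsSpecial {n : ℕ} (f : ⋀[ℂ]^2 (S n)) : Prop :=
  ∀ i j : Fin (2 * n + 2),
    pairing n f (wedge (S n) (mono n i) (mono n j)) ≠ 0 ↔ (i : ℕ) + j = 2 * n + 1

end BinaryForms

end ProjBundle

end

open ProjBundle

/-!
**Linear algebra.** For `α > β` the bivectors `x^{m-i} y^i ∧ x^{m-j} y^j`, where `m = 2n + 1`,
have a weight depending only on `i + j`, which takes the `4n + 1` values `1, …, 4n + 1`. An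
invariant subspace `W` is the sum of its weight parts, and it contains none of the decomposable
bivectors above. Hence each weight carries a form orthogonal to `W`, and as `W` has codimension
`4n + 1`, these forms are a basis of the space of all forms orthogonal to `W`
(`exists_weight_basis`). Since for every bivector `x^{m-i} y^i ∧ x^{m-j} y^j` with `i ≠ j` some
form orthogonal to `W` does not vanish at it, the form of weight `k` has no zero at the entries
`i + j = k`, `i ≠ j`; only the full antidiagonal `k = m` gives a nondegenerate form
(`exists_special_form`).

For `α = β` every form is semi-invariant. If `b` has maximal rank among the forms orthogonal to
`W`, a determinant computation along the pencils `b + ε g` shows that all of them vanish on the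
radical of `b`. A nonzero radical has dimension at least `2`, as the rank of a skew form is even,
and the bivector of two independent vectors in it would be a nonzero decomposable element of `W`
(`exists_nondegenerate`).

Invariant complements exist because the torus acts diagonally: all its operators are polynomials
in the operator of `2`, which is semisimple (`exists_isInvariant_isCompl`). The complement `D` is
made to contain `f` by adding the line of `f`, which is invariant as the torus preserves the
symmetric form up to scalars, to a complement of `W ⊕ ℂ f`.

**Sheaves.** Let `B = ⋀² V / W`. As `W` contains no decomposable bivector, `ϖ_W : Q(-1) ⟶ B ⊗ 𝒪`
is a monomorphism. Its composition with the map `B ⊗ 𝒪 ⟶ 𝒪` induced by `f` is, up to sign, the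
twist of `ᵀg ∘ f`, which is an epimorphism with kernel `N(f)(-1)` because `f` is nondegenerate.
Comparing kernels gives `0 ⟶ N(f)(-1) ⟶ ker f ⊗ 𝒪 ⟶ coker ϖ_W ⟶ 0` with `ker f ⊆ B`
(`shortExact_ker_ker_coker`, `hasExactSeq_of_equiv`). The space `ker f` is identified with `D ∩
ker f`, and it has the same dimension as `D / ℂ f`.

This needs that the twist preserves monomorphisms and kernels (`mono_twist_map`,
`exact_map_twist`) and that `(E ⊗ 𝒪(1)) ⊗ 𝒪(-1) ⟶ E ⊗ 𝒪` is an isomorphism. The twist is the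
sheafification of a tensor product computed on each open set, and sheafification turns properties
of the sections over small open sets into properties of sheaves. On an open subset of `{φ ≠ 0}`,
for a linear form `φ`, the module of sections of `𝒪(-1)` is free on `φ⁻¹`, hence flat.
-/

noncomputable section

namespace ProjBundle

/-! ### Sheafification of presheaves of modules on a topological space -/

section Sheafification

variable {X : TopCat.{0}} {R : Sheaf (Opens.grothendieckTopology X) RingCat.{0}}

/-- `p` holds on all sufficiently small open neighbourhoods of every point of `X`. -/
def OnSmallOpens (p : Opens X → Prop) : Prop :=
  ∀ x : X, ∃ B : Opens X, x ∈ B ∧ ∀ U ≤ B, p U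

lemma OnSmallOpens.mono {p q : Opens X → Prop} (hp : OnSmallOpens p) (h : ∀ U, p U → q U) :
    OnSmallOpens q := fun x =>
  let ⟨B, hx, hB⟩ := hp x
  ⟨B, hx, fun U hU => h U (hB U hU)⟩

variable (R) in
/-- The sheafification functor. -/
abbrev sheafify : PresheafOfModules.{0} R.obj ⥤ SheafOfModules.{0} R :=
  PresheafOfModules.sheafification (𝟙 R.obj)

variable {P Q : PresheafOfModules.{0} R.obj} (f : P ⟶ Q)

lemma isLocallySurjective_of_onSmallOpens
    (h : OnSmallOpens fun U => Function.Surjective (f.app (op U))) :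
    PresheafOfModules.IsLocallySurjective (Opens.grothendieckTopology X) f where
  imageSieve_mem {U} s x hx := by
    obtain ⟨B, hxB, hB⟩ := h x
    obtain ⟨t, ht⟩ := hB (U ⊓ B) inf_le_right (Q.map (homOfLE (inf_le_left : U ⊓ B ≤ U)).op s)
    exact ⟨U ⊓ B, homOfLE inf_le_left, ⟨t, ht⟩, ⟨hx, hxB⟩⟩

lemma isLocallyInjective_of_onSmallOpens
    (h : OnSmallOpens fun U => Function.Injective (f.app (op U))) :
    PresheafOfModules.IsLocallyInjective (Opens.grothendieckTopology X) f where
  equalizerSieve_mem {U} s t hst x hx := by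
    obtain ⟨B, hxB, hB⟩ := h x
    refine ⟨U.unop ⊓ B, homOfLE inf_le_left, ?_, ⟨hx, hxB⟩⟩
    refine hB (U.unop ⊓ B) inf_le_right ?_
    have h1 := PresheafOfModules.naturality_apply f
      (homOfLE (inf_le_left : U.unop ⊓ B ≤ U.unop)).op s
    have h2 := PresheafOfModules.naturality_apply f
      (homOfLE (inf_le_left : U.unop ⊓ B ≤ U.unop)).op t
    have h3 : f.app U s = f.app U t := hst
    exact h1.trans ((congr_arg _ h3).trans h2.symm)

lemma epi_sheafify_map (h : OnSmallOpens fun U => Function.Surjective (f.app (op U))) :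
    Epi ((sheafify R).map f) := by
  have := isLocallySurjective_of_onSmallOpens f h
  have h1 : Sheaf.IsLocallySurjective ((presheafToSheaf _ AddCommGrpCat.{0}).map
      ((PresheafOfModules.toPresheaf R.obj).map f)) :=
    (Presheaf.isLocallySurjective_presheafToSheaf_map_iff _ _).2 this
  have h2 : Epi ((SheafOfModules.toSheaf R).map ((sheafify R).map f)) :=
    Sheaf.epi_of_isLocallySurjective ((presheafToSheaf _ AddCommGrpCat.{0}).map
      ((PresheafOfModules.toPresheaf R.obj).map f))
  exact (SheafOfModules.toSheaf R).epi_of_epi_map h2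

lemma mono_sheafify_map (h : OnSmallOpens fun U => Function.Injective (f.app (op U))) :
    Mono ((sheafify R).map f) := by
  have := isLocallyInjective_of_onSmallOpens f h
  have h1 : Sheaf.IsLocallyInjective ((presheafToSheaf _ AddCommGrpCat.{0}).map
      ((PresheafOfModules.toPresheaf R.obj).map f)) :=
    (Presheaf.isLocallyInjective_presheafToSheaf_map_iff _ _).2 this
  have h2 : Mono ((SheafOfModules.toSheaf R).map ((sheafify R).map f)) :=
    Sheaf.mono_of_isLocallyInjective ((presheafToSheaf _ AddCommGrpCat.{0}).map
      ((PresheafOfModules.toPresheaf R.obj).map f))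
  exact (SheafOfModules.toSheaf R).mono_of_mono_map h2

instance : (sheafify R).Additive :=
  Functor.additive_of_preserves_binary_products _

/-- Sheafification is exact, so that a complex of presheaves which is exact on small open sets
becomes exact. -/
lemma exact_map_sheafify (S : ShortComplex (PresheafOfModules.{0} R.obj))
    (h : OnSmallOpens fun U => ∀ s : S.X₂.obj (op U), S.g.app (op U) s = 0 →
      ∃ t, S.f.app (op U) t = s) :
    (S.map (sheafify R)).Exact := by
  let k := Limits.kernel.lift S.g S.f S.zero
  have hk : Epi ((sheafify R).map k) := epi_sheafify_map k (h.mono fun U hU t => by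
    have h1 : (Limits.kernel.ι S.g).app (op U) t ∈ LinearMap.ker (S.g.app (op U)).hom := by
      have := ConcreteCategory.congr_hom
        (congr_arg (fun g => g.app (op U)) (Limits.kernel.condition S.g)) t
      exact this
    obtain ⟨t', ht'⟩ := hU _ h1
    refine ⟨t', PresheafOfModules.injective_of_mono (Limits.kernel.ι S.g) (op U) ?_⟩
    rw [← ht']
    exact ConcreteCategory.congr_hom
        (congr_arg (fun g => g.app (op U)) (Limits.kernel.lift_ι S.g S.f S.zero)) t')
  have h2 : (ShortComplex.mk _ _ (Limits.kernel.condition S.g)).Exact :=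
    ShortComplex.exact_kernel S.g
  have h3 := h2.map (sheafify R)
  let φ : S.map (sheafify R) ⟶
      (ShortComplex.mk _ _ (Limits.kernel.condition S.g)).map (sheafify R) :=
    { τ₁ := (sheafify R).map k
      τ₂ := 𝟙 _
      τ₃ := 𝟙 _
      comm₁₂ := by
        refine Eq.trans ?_ (Category.comp_id _).symm
        refine ((sheafify R).map_comp _ _).symm.trans ?_
        exact congr_arg _ (Limits.kernel.lift_ι S.g S.f S.zero) }
  have : Epi φ.τ₁ := hk
  have : IsIso φ.τ₂ := inferInstanceAs (IsIso (𝟙 _))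
  have : Mono φ.τ₃ := inferInstanceAs (Mono (𝟙 _))
  exact (ShortComplex.exact_iff_of_epi_of_isIso_of_mono φ).2 h3

/-- The exactness of a complex of sheaves of modules can be checked on sections over small open
sets. -/
lemma exact_of_onSmallOpens (S : ShortComplex (SheafOfModules.{0} R))
    (h : OnSmallOpens fun U => ∀ s : S.X₂.val.obj (op U), S.g.val.app (op U) s = 0 →
      ∃ t, S.f.val.app (op U) t = s) : S.Exact := by
  have h1 := exact_map_sheafify (S.map (SheafOfModules.forget R)) h
  let adj := PresheafOfModules.sheafificationAdjunction (𝟙 R.obj)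
  let e₀ := asIso adj.counit
  let e : SheafOfModules.forget R ⋙ sheafify R ≅ 𝟭 _ := e₀
  exact (ShortComplex.exact_iff_of_iso (S.mapNatIso e)).1 h1

end Sheafification

/-! ### The twist by `𝒪(-1)` -/

section Twist

variable {V : Type} [AddCommGroup V] [Module ℂ V]
variable {E : Type} [AddCommGroup E] [Module ℂ E]

lemma isForm_dual (φ : Module.Dual ℂ V) : IsForm 1 (fun v => φ v) :=
  ⟨fun ψ => Algebra.subset_adjoin ⟨ψ ∘ₗ φ, rfl⟩, fun c v => by simp⟩

/-- The open set `{φ ≠ 0}` of the projective space. -/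
def basicOpen (φ : Module.Dual ℂ V) : Opens (projSpace V) where
  carrier := {x : ℙ ℂ V | φ x.rep ≠ 0}
  is_open' := TopologicalSpace.GenerateOpen.basic _ ⟨1, fun v => φ v, isForm_dual φ, rfl⟩

lemma ne_zero_of_mem_cone {φ : Module.Dual ℂ V} {U : Opens (projSpace V)} (hU : U ≤ basicOpen φ)
    {v : V} (hv : v ∈ cone U) : φ v ≠ 0 := by
  obtain ⟨h0, h1⟩ := hv
  obtain ⟨a, ha⟩ := Projectivization.exists_smul_eq_mk_rep ℂ v h0
  have h2 : φ (Projectivization.mk ℂ v h0).rep ≠ 0 := hU h1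
  rw [← ha, Units.smul_def, map_smul, smul_eq_mul] at h2
  exact right_ne_zero_of_mul h2

lemma onSmallOpens_basicOpen {s : Set (Module.Dual ℂ V)}
    (hs : ∀ v : V, v ≠ 0 → ∃ φ ∈ s, φ v ≠ 0) :
    OnSmallOpens fun U : Opens (projSpace V) => ∃ φ ∈ s, U ≤ basicOpen φ := fun x => by
  obtain ⟨φ, hφ, h⟩ := hs (show ℙ ℂ V from x).rep (Projectivization.rep_nonzero _)
  exact ⟨basicOpen φ, h, fun U hU => ⟨φ, hφ, hU⟩⟩

variable (V) in
lemma onSmallOpens_exists_le_basicOpen :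
    OnSmallOpens fun U : Opens (projSpace V) => ∃ φ, U ≤ basicOpen φ :=
  (onSmallOpens_basicOpen (s := Set.univ) fun v hv => by
    by_contra! h
    exact hv ((Module.forall_dual_apply_eq_zero_iff ℂ _).1 fun φ => h φ trivial)).mono
    fun U ⟨φ, _, h⟩ => ⟨φ, h⟩

lemma isRegular_dual (φ : Module.Dual ℂ V) (U : Opens (projSpace V)) :
    IsRegular 1 U (fun v => φ v) := fun x hx =>
  ⟨U, hx, le_rfl, 1, 0, _, _, by simp, isForm_dual φ, isForm_const 1, fun v hv => by simp⟩

lemma isRegular_inv {φ : Module.Dual ℂ V} {U : Opens (projSpace V)} (hU : U ≤ basicOpen φ) :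
    IsRegular (-1) U (fun v => (φ v)⁻¹) := fun x hx =>
  ⟨U, hx, le_rfl, 0, 1, _, _, by simp, isForm_const 1, isForm_dual φ, fun v hv =>
    ⟨ne_zero_of_mem_cone hU hv, by simp⟩⟩

/-- Over an open subset of `{φ ≠ 0}`, the section `φ⁻¹` generates `𝒪(-1)` freely. -/
def regSecEquiv {φ : Module.Dual ℂ V} {U : Opens (projSpace V)} (hU : U ≤ basicOpen φ) :
    regSec V ℂ (-1) U ≃ₗ[regFun V U] regFun V U where
  toFun s := ⟨fun v => φ v * s.1 v, IsRegular.smul (by simp) s.2 (isRegular_dual φ U)⟩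
  invFun s := ⟨fun v => (φ v)⁻¹ * s.1 v, IsRegular.smul (by simp) s.2 (isRegular_inv hU)⟩
  map_add' s s' := Subtype.ext (funext fun v => mul_add (φ v) (s.1 v) (s'.1 v))
  map_smul' a s := Subtype.ext (funext fun v => mul_left_comm (φ v) (a.1 v) (s.1 v))
  left_inv s := Subtype.ext (funext fun v => inv_mul_cancel_left₀
    (ne_zero_of_mem_cone hU v.2) (s.1 v))
  right_inv s := Subtype.ext (funext fun v => mul_inv_cancel_left₀
    (ne_zero_of_mem_cone hU v.2) (s.1 v))

lemma flat_regSec {φ : Module.Dual ℂ V} {U : Opens (projSpace V)} (hU : U ≤ basicOpen φ) :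
    Module.Flat (regFun V U) (regSec V ℂ (-1) U) :=
  Module.Flat.of_linearEquiv (regSecEquiv hU)

lemma contrApp_bijective {φ : Module.Dual ℂ V} {U : Opens (projSpace V)} (hU : U ≤ basicOpen φ) :
    Function.Bijective (contrApp V E U) := by
  let r₀ : regSec V ℂ (-1) U := ⟨fun v => (φ v)⁻¹, isRegular_inv hU⟩
  have hr : ∀ r : regSec V ℂ (-1) U, r = regSecEquiv hU r • r₀ := fun r =>
    Subtype.ext (funext fun v => by
      change r.1 v = (φ v * r.1 v) * (φ v)⁻¹
      rw [mul_comm (φ v), mul_inv_cancel_right₀ (ne_zero_of_mem_cone hU v.2)])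
  have ht : ∀ t : TensorProduct (regFun V U) (regSec V E 1 U) (regSec V ℂ (-1) U),
      ∃ s, t = s ⊗ₜ r₀ := fun t => by
    induction t using TensorProduct.induction_on with
    | zero => exact ⟨0, (TensorProduct.zero_tmul _ _).symm⟩
    | tmul s r => exact ⟨regSecEquiv hU r • s, by rw [TensorProduct.smul_tmul, ← hr]⟩
    | add t t' h h' =>
      obtain ⟨s, rfl⟩ := h
      obtain ⟨s', rfl⟩ := h'
      exact ⟨s + s', (TensorProduct.add_tmul _ _ _).symm⟩
  constructor
  · rw [injective_iff_map_eq_zero]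
    intro t h0
    obtain ⟨s, rfl⟩ := ht t
    have : s = 0 := Subtype.ext (funext fun v => by
      have h1 : (φ v)⁻¹ • s.1 v = 0 := congr_fun (congr_arg Subtype.val h0) v
      exact (smul_eq_zero.1 h1).resolve_left (inv_ne_zero (ne_zero_of_mem_cone hU v.2)))
    rw [this, TensorProduct.zero_tmul]
  · intro s
    refine ⟨(⟨fun v => φ v • s.1 v, IsRegular.smul (by simp) s.2 (isRegular_dual φ U)⟩ :
      regSec V E 1 U) ⊗ₜ r₀, Subtype.ext (funext fun v => ?_)⟩
    exact inv_smul_smul₀ (ne_zero_of_mem_cone hU v.2) (s.1 v)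

/-- The counit of the sheafification adjunction: a sheaf is its own sheafification. -/
def counitIso : SheafOfModules.forget (structureSheaf V) ⋙ sheafify (structureSheaf V) ≅ 𝟭 _ :=
  let adj := PresheafOfModules.sheafificationAdjunction (𝟙 (structureSheaf V).obj)
  let e := asIso adj.counit
  e

variable (V E) in
lemma contr_eq : contr V E =
    (sheafify (structureSheaf V)).map (contrPre V E) ≫ counitIso.hom.app (twisted V E 0) :=
  (PresheafOfModules.sheafificationAdjunction (𝟙 (structureSheaf V).obj)).homEquiv_counit ..

/-- Over an open subset of `{φ ≠ 0}` the multiplication `(E ⊗ 𝒪(1)) ⊗ 𝒪(-1) ⟶ E ⊗ 𝒪` is already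
bijective on the presheaf tensor product. -/
instance : IsIso (contr V E) := by
  have h1 : Mono ((sheafify (structureSheaf V)).map (contrPre V E)) :=
    mono_sheafify_map _ ((onSmallOpens_exists_le_basicOpen V).mono
      fun U ⟨φ, hφ⟩ => (contrApp_bijective hφ).1)
  have h2 : Epi ((sheafify (structureSheaf V)).map (contrPre V E)) :=
    epi_sheafify_map _ ((onSmallOpens_exists_le_basicOpen V).mono
      fun U ⟨φ, hφ⟩ => (contrApp_bijective hφ).2)
  have h3 : IsIso ((sheafify (structureSheaf V)).map (contrPre V E)) := isIso_of_mono_of_epi _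
  rw [contr_eq]
  exact @IsIso.comp_isIso _ _ _ _ _ _ _ h3 (NatIso.hom_app_isIso counitIso (twisted V E 0))

variable {F G : Mod V}

instance (F : Mod V) (U : Opens (projSpace V)) : Module (regFun V U) (F.val.obj (op U)) :=
  inferInstanceAs (Module ((structureSheaf V).obj.obj (op U)) (F.val.obj (op U)))

/-- The map induced by a morphism of sheaves of modules on the sections over `U`. -/
def secMap (f : F ⟶ G) (U : Opens (projSpace V)) :
    F.val.obj (op U) →ₗ[regFun V U] G.val.obj (op U) := (f.val.app (op U)).hom

instance mono_twist_map (f : F ⟶ G) [Mono f] : Mono ((twist V).map f) := by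
  refine mono_sheafify_map _ ((onSmallOpens_exists_le_basicOpen V).mono fun U ⟨φ, hφ⟩ => ?_)
  have := flat_regSec hφ
  have : Mono f.val := inferInstanceAs (Mono ((SheafOfModules.forget _).map f))
  exact Module.Flat.rTensor_preserves_injective_linearMap (M := regSec V ℂ (-1) U) (secMap f U)
    (PresheafOfModules.injective_of_mono f.val (op U))

/-- Surjectivity is required on sections over small open sets, where the tensor product preserves
it. -/
lemma epi_twist_map (f : F ⟶ G) (h : OnSmallOpens fun U => Function.Surjective (secMap f U)) :
    Epi ((twist V).map f) :=
  epi_sheafify_map _ (h.mono fun U hU =>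
    LinearMap.rTensor_surjective (regSec V ℂ (-1) U) (g := secMap f U) hU)

lemma preTwist_map_zero : (preTwist V).map (0 : F ⟶ G).val = 0 := by
  ext U x
  exact LinearMap.congr_fun
    (LinearMap.rTensor_zero (R := regFun V U.unop) (regSec V ℂ (-1) U.unop)
      (N := F.val.obj (op U.unop)) (P := G.val.obj (op U.unop))) x

instance : (twist V).PreservesZeroMorphisms where
  map_zero _ _ := (congr_arg _ preTwist_map_zero).trans
    ((sheafify (structureSheaf V)).map_zero _ _)

/-- The twist preserves left exact sequences: their sections over a small open set form a left exact
sequence, which remains exact after the tensor product with a flat module. -/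
lemma exact_map_twist {S : ShortComplex (Mod V)} (hS : S.Exact) [Mono S.f] :
    (S.map (twist V)).Exact := by
  have h0 : (preTwist V).map S.f.val ≫ (preTwist V).map S.g.val = 0 := by
    rw [← Functor.map_comp, ← SheafOfModules.comp_val, S.zero, preTwist_map_zero]
  refine exact_map_sheafify (ShortComplex.mk ((preTwist V).map S.f.val)
    ((preTwist V).map S.g.val) h0) ((onSmallOpens_exists_le_basicOpen V).mono fun U ⟨φ, hφ⟩ => ?_)
  have h1 : ((S.map (SheafOfModules.forget (structureSheaf V))).map
      (PresheafOfModules.evaluation _ (op U))).Exact :=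
    (hS.map_of_mono_of_preservesKernel (SheafOfModules.forget (structureSheaf V))
      inferInstance inferInstance).map _
  have h2 : Function.Exact (secMap S.f U) (secMap S.g U) :=
    (ShortComplex.ShortExact.moduleCat_exact_iff_function_exact _).1 h1
  intro t ht
  exact (@Module.Flat.rTensor_exact (regFun V U) (regSec V ℂ (-1) U) _ _ _ (flat_regSec hφ)
    _ _ _ _ _ _ _ _ _ (secMap S.f U) (secMap S.g U) h2 t).1 ht

end Twist

/-! ### Morphisms induced by constant linear maps -/

section Const

variable {V : Type} [AddCommGroup V] [Module ℂ V]
variable {E E' E'' : Type} [AddCommGroup E] [Module ℂ E] [AddCommGroup E'] [Module ℂ E']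
  [AddCommGroup E''] [Module ℂ E'']

lemma IsRegular.map (A : E →ₗ[ℂ] E') {d : ℤ} {U : Opens (projSpace V)} {s : cone U → E}
    (h : IsRegular d U s) : IsRegular d U (fun v => A (s v)) := by
  intro x hx
  obtain ⟨U₁, hx₁, hU₁, k, l, p, q, hkl, hp, hq, e⟩ := h x hx
  refine ⟨U₁, hx₁, hU₁, k, l, fun v => A (p v), q, hkl,
    ⟨fun φ => hp.1 (φ ∘ₗ A), fun c v => by simp only [hp.2, map_smul]⟩, hq, fun v hv => ?_⟩
  obtain ⟨a, b⟩ := e v hv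
  exact ⟨a, (congr_arg A b).trans (map_smul A _ _)⟩

variable (V) in
/-- The morphism `E ⊗ 𝒪(d) ⟶ E' ⊗ 𝒪(d)` defined by a linear map `E → E'`. -/
def constMap (A : E →ₗ[ℂ] E') (d : ℤ) : twisted V E d ⟶ twisted V E' d where
  val := PresheafOfModules.homMk
    { app := fun U => AddCommGrpCat.ofHom
        { toFun := fun s : regSec V E d U.unop =>
            (⟨fun v => A (s.1 v), s.2.map A⟩ : regSec V E' d U.unop)
          map_zero' := Subtype.ext (funext fun _ => map_zero A)
          map_add' := fun s s' => Subtype.ext (funext fun v => map_add A (s.1 v) (s'.1 v)) }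
      naturality := fun _ _ _ => rfl }
    (fun U (r : regFun V U.unop) (s : regSec V E d U.unop) =>
      Subtype.ext (funext fun v => map_smul A (r.1 v) (s.1 v)))

/-- Morphisms into `E ⊗ 𝒪(d)` are determined by the values of the images of sections. -/
lemma hom_ext_twisted {F : Mod V} {d : ℤ} {f g : F ⟶ twisted V E d}
    (h : ∀ (U : Opens (projSpace V)) (s : F.val.obj (op U)) (v : cone U),
      (show regSec V E d U from secMap f U s).1 v = (show regSec V E d U from secMap g U s).1 v) :
    f = g := by
  apply SheafOfModules.hom_ext
  ext U s
  exact Subtype.ext (funext fun v => h U.unop s v)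

lemma constMap_comp (A : E →ₗ[ℂ] E') (B : E' →ₗ[ℂ] E'') (d : ℤ) :
    constMap V A d ≫ constMap V B d = constMap V (B ∘ₗ A) d := hom_ext_twisted fun _ _ _ => rfl

lemma constMap_id (d : ℤ) : constMap V (LinearMap.id : E →ₗ[ℂ] E) d = 𝟙 _ :=
  hom_ext_twisted fun _ _ _ => rfl

lemma constMap_zero (d : ℤ) : constMap V (0 : E →ₗ[ℂ] E') d = 0 :=
  hom_ext_twisted fun _ _ _ => rfl

lemma constMap_add (A B : E →ₗ[ℂ] E') (d : ℤ) :
    constMap V (A + B) d = constMap V A d + constMap V B d :=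
  hom_ext_twisted fun _ _ _ => rfl

lemma linMap_comp_constMap [FiniteDimensional ℂ E] (L : V →ₗ[ℂ] E →ₗ[ℂ] E') (A : E' →ₗ[ℂ] E'')
    (d d' : ℤ) (hd : d' = d + 1) :
    linMap L d d' hd ≫ constMap V A d' = linMap (L.compr₂ A) d d' hd :=
  hom_ext_twisted fun _ _ _ => rfl

/-- The action of a linear map on the sections over `U`. -/
def constSec (A : E →ₗ[ℂ] E') (d : ℤ) (U : Opens (projSpace V)) :
    regSec V E d U →ₗ[regFun V U] regSec V E' d U where
  toFun s := ⟨fun v => A (s.1 v), s.2.map A⟩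
  map_add' s s' := Subtype.ext (funext fun v => map_add A (s.1 v) (s'.1 v))
  map_smul' r s := Subtype.ext (funext fun v => map_smul A (r.1 v) (s.1 v))

lemma contrApp_comp_rTensor (A : E →ₗ[ℂ] E') (U : Opens (projSpace V)) :
    contrApp V E' U ∘ₗ (constSec A 1 U).rTensor (regSec V ℂ (-1) U) =
      constSec A 0 U ∘ₗ contrApp V E U :=
  TensorProduct.ext' fun s r =>
    Subtype.ext (funext fun v => (map_smul A (r.1 v) (s.1 v)).symm)

/-- Multiplication with sections of `𝒪(-1)` is natural in the vector space `E`. -/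
lemma contr_naturality (A : E →ₗ[ℂ] E') :
    (twist V).map (constMap V A 1) ≫ contr V E' = contr V E ≫ constMap V A 0 := by
  have h : (preTwist V).map (constMap V A 1).val ≫ contrPre V E' =
      contrPre V E ≫ (constMap V A 0).val := by
    ext U : 1
    have h0 := congr_arg (ModuleCat.ofHom (R := regFun V U.unop)) (contrApp_comp_rTensor A U.unop)
    exact h0
  have h1 : (sheafify (structureSheaf V)).map ((preTwist V).map (constMap V A 1).val) ≫
      (sheafify (structureSheaf V)).map (contrPre V E') =
      (sheafify (structureSheaf V)).map (contrPre V E) ≫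
      (sheafify (structureSheaf V)).map (constMap V A 0).val := by
    rw [← Functor.map_comp, h, Functor.map_comp]
  have h2 : (sheafify (structureSheaf V)).map (constMap V A 0).val ≫
      counitIso.hom.app (twisted V E' 0) =
      counitIso.hom.app (twisted V E 0) ≫ constMap V A 0 :=
    counitIso.hom.naturality (constMap V A 0)
  rw [contr_eq, contr_eq]
  refine Eq.trans (Category.assoc _ _ _).symm ?_
  refine (congr_arg (· ≫ counitIso.hom.app (twisted V E' 0)) h1).trans ?_
  refine (Category.assoc _ _ _).trans ?_
  refine (congr_arg ((sheafify (structureSheaf V)).map (contrPre V E) ≫ ·) h2).trans ?_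
  exact (Category.assoc _ _ _).symm

/-- A split exact sequence of vector spaces gives a split exact sequence of sheaves. -/
lemma shortExact_constMap (κ : E →ₗ[ℂ] E') (q : E' →ₗ[ℂ] E'') (hκ : Function.Injective κ)
    (hq : Function.Surjective q) (h : Function.Exact κ q) (d : ℤ) :
    (ShortComplex.mk (constMap V κ d) (constMap V q d)
      (by rw [constMap_comp, h.linearMap_comp_eq_zero, constMap_zero])).ShortExact := by
  obtain ⟨σ, hσ⟩ := q.exists_rightInverse_of_surjective (LinearMap.range_eq_top.2 hq)
  obtain ⟨ρ, hρ⟩ := κ.exists_leftInverse_of_injective (LinearMap.ker_eq_bot.2 hκ)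
  -- the retraction is corrected so as to vanish on the section
  have hid : κ ∘ₗ (ρ ∘ₗ (LinearMap.id - σ ∘ₗ q)) + σ ∘ₗ q = LinearMap.id := by
    ext x
    have hx : q (x - σ (q x)) = 0 := by
      rw [map_sub, ← LinearMap.comp_apply q σ, hσ, LinearMap.id_apply, sub_self]
    obtain ⟨y, hy⟩ := (h _).1 hx
    have : ρ (κ y) = y := LinearMap.congr_fun hρ y
    simp [← hy, this]
    simp [hy]
  have hr : (ρ ∘ₗ (LinearMap.id - σ ∘ₗ q)) ∘ₗ κ = LinearMap.id := by
    ext x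
    have h1 : q (κ x) = 0 := (h _).2 ⟨x, rfl⟩
    simpa [h1] using LinearMap.congr_fun hρ x
  exact ShortComplex.Splitting.shortExact
    { r := constMap V (ρ ∘ₗ (LinearMap.id - σ ∘ₗ q)) d
      s := constMap V σ d
      f_r := by simp only [constMap_comp, hr, constMap_id]
      s_g := by simp only [constMap_comp, hσ, constMap_id]
      id := by simp only [constMap_comp, ← constMap_add, hid, constMap_id] }

end Const

/-! ### The exact sequence -/

section Abelian

variable {C : Type*} [Category C] [Abelian C]

/-- If `m : X ⟶ B` is a monomorphism whose composition `e` with `q : B ⟶ Y` is an epimorphism, then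
`ker e ⟶ ker q ⟶ coker m` is a short exact sequence. -/
lemma shortExact_ker_ker_coker {N X B Y K : C} (m : X ⟶ B) [Mono m] (q : B ⟶ Y) (e : X ⟶ Y)
    [Epi e] (he : m ≫ q = e) (ι : N ⟶ X) [Mono ι] (hι : ι ≫ e = 0)
    (hN : (ShortComplex.mk ι e hι).Exact)
    (κ : K ⟶ B) (hκ : κ ≫ q = 0) (hK : (ShortComplex.mk κ q hκ).ShortExact) :
    ∃ (i : N ⟶ K) (p : K ⟶ Limits.cokernel m) (h : i ≫ p = 0),
      (ShortComplex.mk i p h).ShortExact := by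
  have : Mono κ := hK.mono_f
  have : Epi q := hK.epi_g
  have hw : (ι ≫ m) ≫ q = 0 := by rw [Category.assoc, he, hι]
  let i : N ⟶ K := hK.exact.lift (ι ≫ m) hw
  have hi : i ≫ κ = ι ≫ m := hK.exact.lift_f _ _
  have h : i ≫ κ ≫ Limits.cokernel.π m = 0 := by
    rw [← Category.assoc, hi, Category.assoc, Limits.cokernel.condition, Limits.comp_zero]
  have h1 : Mono i := by
    have : Mono (i ≫ κ) := by rw [hi]; infer_instance
    exact mono_of_mono i κ
  have h2 : Epi (κ ≫ Limits.cokernel.π m) := by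
    refine Preadditive.epi_of_cancel_zero _ fun {Z} g hg => ?_
    rw [Category.assoc] at hg
    have h3 : q ≫ hK.exact.desc _ hg = Limits.cokernel.π m ≫ g := hK.exact.g_desc _ _
    have h4 : e ≫ hK.exact.desc _ hg = 0 := by
      rw [← he, Category.assoc, h3, Limits.cokernel.condition_assoc, Limits.zero_comp]
    have h5 : hK.exact.desc _ hg = 0 := (cancel_epi e).1 (h4.trans Limits.comp_zero.symm)
    rw [← cancel_epi (Limits.cokernel.π m), ← h3, h5, Limits.comp_zero, Limits.comp_zero]
  refine ⟨i, _, h, ?_⟩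
  refine ShortComplex.ShortExact.mk' ?_ h1 h2
  rw [ShortComplex.exact_iff_exact_up_to_refinements]
  intro A x hx
  have hm : (ShortComplex.mk m _ (Limits.cokernel.condition m)).Exact :=
    ShortComplex.exact_cokernel m
  have hx' : (x ≫ κ) ≫ Limits.cokernel.π m = 0 := by rw [Category.assoc]; exact hx
  let y := hm.lift (x ≫ κ) hx'
  have hy : y ≫ m = x ≫ κ := hm.lift_f _ _
  have hy' : y ≫ e = 0 := by rw [← he, ← Category.assoc, hy, Category.assoc, hκ, Limits.comp_zero]
  refine ⟨A, 𝟙 A, inferInstance, hN.lift y hy', ?_⟩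
  rw [← cancel_mono κ]
  have h5 : hN.lift y hy' ≫ ι = y := hN.lift_f _ _
  simp only [Category.id_comp, Category.assoc, hi]
  rw [← Category.assoc, h5, hy]

end Abelian

section Sequence

variable {V : Type} [AddCommGroup V] [Module ℂ V]
variable {E E' : Type} [AddCommGroup E] [Module ℂ E] [AddCommGroup E'] [Module ℂ E']

lemma wedge_swap (u v : V) : wedge V u v = -wedge V v u := by
  have h := wedge_self V (u + v)
  simp only [map_add, LinearMap.add_apply, wedge_self, zero_add, add_zero] at h
  exact eq_neg_of_add_eq_zero_left (by rw [add_comm]; exact h)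

/-- The decomposable bivector of two vectors vanishes only if they are proportional. -/
lemma exists_eq_smul_of_wedge_eq_zero {v s : V} (hv : v ≠ 0) (h : wedge V v s = 0) :
    ∃ c : ℂ, s = c • v := by
  obtain ⟨φ, hφ⟩ : ∃ φ : Module.Dual ℂ V, φ v = 1 := Module.Projective.exists_dual_eq_one ℂ hv
  refine ⟨φ s, ?_⟩
  rw [← sub_eq_zero]
  refine (Module.forall_dual_apply_eq_zero_iff ℂ _).1 fun ψ => ?_
  have h1 := exteriorPower.pairingDual_ιMulti_ιMulti (R := ℂ) ![φ, ψ] ![v, s]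
  have h2 : exteriorPower.ιMulti ℂ 2 ![v, s] = 0 := h
  rw [h2, map_zero, Matrix.det_fin_two] at h1
  simp [hφ] at h1
  rw [map_sub, map_smul, smul_eq_mul]
  linear_combination -h1

variable (V) in
/-- The projection `V ⊗ 𝒪 ⟶ Q`. -/
def quotπ : twisted V V 0 ⟶ quotBundle V := Limits.cokernel.π (taut V)

instance : Epi (quotπ V) := inferInstanceAs (Epi (Limits.cokernel.π (taut V)))

lemma taut_quotπ : taut V ≫ quotπ V = 0 := Limits.cokernel.condition (taut V)

variable [FiniteDimensional ℂ V]

lemma quotπ_quotDesc (L : V →ₗ[ℂ] V →ₗ[ℂ] E) (hL : ∀ v, L v v = 0) :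
    quotπ V ≫ quotDesc L hL = linMap L 0 1 (by norm_num) :=
  Limits.cokernel.π_desc _ _ _

lemma quotDesc_comp_constMap (L : V →ₗ[ℂ] V →ₗ[ℂ] E) (hL : ∀ v, L v v = 0) (A : E →ₗ[ℂ] E')
    (L' : V →ₗ[ℂ] V →ₗ[ℂ] E') (hL' : ∀ v, L' v v = 0) (h : L.compr₂ A = L') :
    quotDesc L hL ≫ constMap V A 1 = quotDesc L' hL' := by
  subst h
  rw [← cancel_epi (quotπ V), ← Category.assoc, quotπ_quotDesc, quotπ_quotDesc,
    linMap_comp_constMap]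

/-- If the kernel of `L v` is the line of `v` for every `v ≠ 0`, then `L` embeds `Q` into
`E ⊗ 𝒪(1)`. -/
lemma mono_quotDesc (L : V →ₗ[ℂ] V →ₗ[ℂ] E) (hL : ∀ v, L v v = 0)
    (h : ∀ v s, v ≠ 0 → L v s = 0 → ∃ c : ℂ, s = c • v) : Mono (quotDesc L hL) := by
  have hw : taut V ≫ linMap L 0 1 (by norm_num) = 0 := by
    rw [← quotπ_quotDesc L hL, ← Category.assoc, taut_quotπ, Limits.zero_comp]
  have hex : (ShortComplex.mk _ _ hw).Exact := by
    refine exact_of_onSmallOpens _ ((onSmallOpens_exists_le_basicOpen V).mono ?_)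
    rintro U ⟨φ, hφ⟩ (s : regSec V V 0 U) hs
    have hs' : ∀ v : cone U, L v (s.1 v) = 0 := fun v => congr_fun (congr_arg Subtype.val hs) v
    -- on `{φ ≠ 0}` the coefficient of `s v` along `v` is `φ (s v) / φ v`
    refine ⟨(⟨fun v => (φ v)⁻¹ • φ (s.1 v), IsRegular.smul (by simp) (s.2.map φ)
      (isRegular_inv hφ)⟩ : regSec V ℂ (-1) U), Subtype.ext (funext fun v => ?_)⟩
    obtain ⟨c, hc⟩ := h v.1 _ v.2.1 (hs' v)
    change ((φ v)⁻¹ • φ (s.1 v)) • v.1 = s.1 v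
    rw [hc, map_smul, smul_eq_mul, smul_eq_mul, mul_comm c,
      inv_mul_cancel_left₀ (ne_zero_of_mem_cone hφ v.2)]
  exact hex.mono_cokernelDesc

/-- If every `L v`, for `v ≠ 0`, is a nonzero linear form, then `Q(-1) ⟶ 𝒪` is an epimorphism. -/
lemma epi_twist_quotDesc (L : V →ₗ[ℂ] V →ₗ[ℂ] ℂ) (hL : ∀ v, L v v = 0)
    (h : ∀ v, v ≠ 0 → ∃ s, L v s ≠ 0) : Epi ((twist V).map (quotDesc L hL)) := by
  have h1 : Epi ((twist V).map (linMap L 0 1 (by norm_num))) := by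
    refine epi_twist_map _ ((onSmallOpens_basicOpen (s := Set.range L.flip) ?_).mono ?_)
    · intro v hv
      obtain ⟨s, hs⟩ := h v hv
      exact ⟨_, ⟨s, rfl⟩, hs⟩
    · rintro U ⟨_, ⟨s, rfl⟩, hU⟩ (r : regSec V ℂ 1 U)
      refine ⟨(⟨fun v => (L.flip s v)⁻¹ • (r.1 v • s), ?_⟩ : regSec V V 0 U),
        Subtype.ext (funext fun v => ?_)⟩
      · exact IsRegular.smul (by norm_num)
          (IsRegular.smul (d'' := 1) (by norm_num) (IsRegular.const U s) r.2) (isRegular_inv hU)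
      · change L v.1 ((L.flip s v)⁻¹ • (r.1 v • s)) = r.1 v
        have := ne_zero_of_mem_cone hU v.2
        rw [LinearMap.flip_apply] at this ⊢
        rw [map_smul, map_smul, smul_eq_mul, smul_eq_mul]
        field_simp
  rw [← quotπ_quotDesc L hL, Functor.map_comp] at h1
  exact epi_of_epi ((twist V).map (quotπ V)) _

variable {ω : Module.Dual ℂ (⋀[ℂ]^2 V)} {W : Submodule ℂ (⋀[ℂ]^2 V)}

/-- The kernel of the linear form induced by `ω` on `⋀² V / W` gives an exact sequence
`0 ⟶ N(f)(-1) ⟶ E ⊗ 𝒪 ⟶ F(W)(1) ⟶ 0`, for any `E` isomorphic to this kernel. -/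
lemma hasExactSeq_of_equiv (hω0 : ω ≠ 0)
    (hω : ∀ u, (∀ v, ω (wedge V u v) = 0) → u = 0)
    (hW : ∀ u v : V, wedge V u v ∈ W → wedge V u v = 0) (hωW : W ≤ LinearMap.ker ω)
    (e : E ≃ₗ[ℂ] LinearMap.ker (W.liftQ ω hωW)) : HasExactSeq ω E W := by
  let L := (wedge V).compr₂ W.mkQ
  have hL : ∀ v, L v v = 0 := fun v => by simp [L, wedge_self]
  -- the sign accounts for `v ∧ s = - s ∧ v`
  let q : (⋀[ℂ]^2 V ⧸ W) →ₗ[ℂ] ℂ := -W.liftQ ω hωW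
  let κ : E →ₗ[ℂ] (⋀[ℂ]^2 V ⧸ W) := (LinearMap.ker (W.liftQ ω hωW)).subtype ∘ₗ e.toLinearMap
  have hm : Mono (quotDesc L hL) := mono_quotDesc L hL fun v s hv h =>
    exists_eq_smul_of_wedge_eq_zero hv (hW v s ((Submodule.Quotient.mk_eq_zero W).1 h))
  have hf : quotDesc L hL ≫ constMap V q 1 = formMap ω :=
    quotDesc_comp_constMap _ _ _ _ _ (by
      ext v s
      simp only [L, q, LinearMap.compr₂_apply, LinearMap.flip_apply, LinearMap.neg_apply,
        Submodule.mkQ_apply, Submodule.liftQ_apply]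
      rw [wedge_swap, map_neg, neg_neg])
  have he : tangoMap W ≫ constMap V q 0 = (twist V).map (formMap ω) ≫ contr V ℂ := by
    change ((twist V).map (quotDesc L hL) ≫ contr V _) ≫ _ = _
    rw [Category.assoc, ← contr_naturality, ← Category.assoc, ← Functor.map_comp, hf]
  have hne : ∀ v, v ≠ 0 → ∃ s, ((wedge V).flip.compr₂ ω) v s ≠ 0 := fun v hv => by
    by_contra! h
    refine hv (hω v fun s => ?_)
    rw [wedge_swap, map_neg, neg_eq_zero]
    exact h s
  have h1 : Epi ((twist V).map (formMap ω)) := epi_twist_quotDesc _ _ hne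
  have h2 : Mono (tangoMap W) := mono_comp ((twist V).map (quotDesc L hL)) (contr V _)
  let ι : nullCorr ω ⟶ quotBundle V := Limits.kernel.ι (formMap ω)
  have hι0 : ι ≫ formMap ω = 0 := Limits.kernel.condition _
  have : Mono ι := inferInstanceAs (Mono (Limits.kernel.ι (formMap ω)))
  have h3 : ((ShortComplex.mk ι _ hι0).map (twist V)).Exact :=
    exact_map_twist (ShortComplex.exact_kernel (formMap ω))
  have hι : (twist V).map ι ≫ (twist V).map (formMap ω) ≫ contr V ℂ = 0 := by
    rw [← Category.assoc, ← Functor.map_comp, hι0, Functor.map_zero,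
      Limits.zero_comp]
  have h4 : (ShortComplex.mk _ _ hι).Exact := by
    let τ : (ShortComplex.mk ι _ hι0).map (twist V) ⟶ ShortComplex.mk _ _ hι :=
      { τ₁ := 𝟙 _, τ₂ := 𝟙 _, τ₃ := contr V ℂ }
    have h5 : Epi τ.τ₁ := inferInstanceAs (Epi (𝟙 _))
    have h6 : IsIso τ.τ₂ := inferInstanceAs (IsIso (𝟙 _))
    have h7 : Mono τ.τ₃ := inferInstanceAs (Mono (contr V ℂ))
    exact (ShortComplex.exact_iff_of_epi_of_isIso_of_mono τ).1 h3
  have hq : Function.Surjective q := by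
    refine LinearMap.surjective fun h0 => hω0 (LinearMap.ext fun x => ?_)
    simpa [q] using LinearMap.congr_fun h0 (W.mkQ x)
  have hκ : Function.Exact κ q := by
    intro x
    constructor
    · intro hx
      refine ⟨e.symm ⟨x, by simpa [q] using hx⟩, by simp [κ]⟩
    · rintro ⟨y, rfl⟩
      simp [q, κ]
  exact shortExact_ker_ker_coker (tangoMap W) (constMap V q 0) _ he ((twist V).map ι) hι h4 _ _
    (shortExact_constMap κ q (Subtype.val_injective.comp e.injective) hq hκ 0)

end Sequence

/-! ### Nondegenerate members of linear systems of skew forms -/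

section Skew

variable {V : Type} [AddCommGroup V] [Module ℂ V]

/-- The Gram matrix of a form `b` on a complement `C` of its radical is invertible. -/
lemma det_gram_ne_zero {b : V →ₗ[ℂ] V →ₗ[ℂ] ℂ} (hb : b.IsAlt) {C : Submodule ℂ V}
    (hC : IsCompl (LinearMap.ker b) C) {r : ℕ} (c : Module.Basis (Fin r) ℂ C) :
    (Matrix.of fun i j => b (c i) (c j)).det ≠ 0 := by
  rw [Ne, ← Matrix.exists_vecMul_eq_zero_iff]
  rintro ⟨x, hx, h⟩
  apply hx
  have h1 : (∑ i, x i • c i : C) = 0 := by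
    have h2 : ((∑ i, x i • c i : C) : V) ∈ LinearMap.ker b := by
      rw [LinearMap.mem_ker]
      ext v
      obtain ⟨k, hk, w, hw, rfl⟩ := Submodule.mem_sup.1
        (show v ∈ LinearMap.ker b ⊔ C from hC.sup_eq_top ▸ Submodule.mem_top)
      have h3 : b (∑ i, x i • c i : C) k = 0 := by
        rw [← hb.neg, LinearMap.mem_ker.1 hk]; simp
      have h4 : (b (∑ i, x i • c i : C)).domRestrict C = 0 := c.ext fun j => by
        have := congr_fun h j
        simpa [Matrix.vecMul, dotProduct] using this
      have h5 := LinearMap.congr_fun h4 ⟨w, hw⟩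
      rw [map_add, h3, zero_add]
      exact h5
    exact Subtype.ext (Submodule.disjoint_def.1 hC.disjoint _ h2 (∑ i, x i • c i : C).2)
  exact funext (Fintype.linearIndependent_iff.1 c.linearIndependent x h1)

variable [FiniteDimensional ℂ V]

/-- A skew form has even rank. -/
lemma even_finrank_compl {b : V →ₗ[ℂ] V →ₗ[ℂ] ℂ} (hb : b.IsAlt) {C : Submodule ℂ V}
    (hC : IsCompl (LinearMap.ker b) C) : Even (Module.finrank ℂ C) := by
  have h := det_gram_ne_zero hb hC (Module.finBasis ℂ C)
  set M : Matrix (Fin (Module.finrank ℂ C)) (Fin (Module.finrank ℂ C)) ℂ :=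
    Matrix.of fun i j => b (Module.finBasis ℂ C i) (Module.finBasis ℂ C j) with hM
  have h1 : M.transpose = -M := by
    ext i j
    simp [hM, hb.neg]
  have h2 := M.det_transpose
  rw [h1, Matrix.det_neg, Fintype.card_fin] at h2
  by_contra hodd
  rw [Nat.not_even_iff_odd] at hodd
  rw [hodd.neg_one_pow] at h2
  apply h
  linear_combination (-1 / 2 : ℂ) * h2

/-- If `b` has maximal rank among the forms `b + ε • g`, then `g` vanishes on the radical of `b`. -/
lemma apply_eq_zero_of_maximal_rank {b g : V →ₗ[ℂ] V →ₗ[ℂ] ℂ} (hb : b.IsAlt)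
    (hmax : ∀ ε : ℂ, Module.finrank ℂ (LinearMap.range (b + ε • g)) ≤
      Module.finrank ℂ (LinearMap.range b))
    {u v : V} (hu : u ∈ LinearMap.ker b) (hv : v ∈ LinearMap.ker b) : g u v = 0 := by
  by_contra hg
  obtain ⟨C, hC⟩ := Submodule.exists_isCompl (LinearMap.ker b)
  let c := Module.finBasis ℂ C
  -- the Gram matrix of `b + ε g` on `C ⊕ ℂ u` and `C ⊕ ℂ v`, with the last column divided by `ε`
  let M : ℂ → Matrix (Fin (Module.finrank ℂ C) ⊕ Unit) (Fin (Module.finrank ℂ C) ⊕ Unit) ℂ :=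
    fun ε => Matrix.fromBlocks (Matrix.of fun i j => b (c i) (c j) + ε * g (c i) (c j))
      (Matrix.of fun i _ => g (c i) v) (Matrix.of fun _ j => ε * g u (c j))
      (Matrix.of fun _ _ => g u v)
  have hM0 : (M 0).det ≠ 0 := by
    have h0 : M 0 = Matrix.fromBlocks (Matrix.of fun i j => b (c i) (c j))
        (Matrix.of fun i _ => g (c i) v) 0 (Matrix.of fun _ _ => g u v) := by
      ext (i | i) (j | j) <;> simp [M]
    rw [h0, Matrix.det_fromBlocks_zero₂₁]
    exact mul_ne_zero (det_gram_ne_zero hb hC c) (by simpa using hg)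
  have hcont : Continuous fun ε => (M ε).det := by
    refine Continuous.matrix_det (continuous_matrix fun i j => ?_)
    rcases i with i | i <;> rcases j with j | j <;> simp only [M, Matrix.fromBlocks_apply₁₁,
      Matrix.fromBlocks_apply₁₂, Matrix.fromBlocks_apply₂₁, Matrix.fromBlocks_apply₂₂,
      Matrix.of_apply] <;> fun_prop
  obtain ⟨ε, hε, hε0⟩ : ∃ ε : ℂ, (M ε).det ≠ 0 ∧ ε ≠ 0 := by
    have h1 : ∀ᶠ ε in nhdsWithin (0 : ℂ) {0}ᶜ, (M ε).det ≠ 0 :=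
      (hcont.continuousAt.eventually_ne hM0).filter_mono nhdsWithin_le_nhds
    exact (h1.and self_mem_nhdsWithin).exists
  -- evaluation at the basis of `C` and at `ε⁻¹ v`
  let ev : Module.Dual ℂ V →ₗ[ℂ] (Fin (Module.finrank ℂ C) ⊕ Unit → ℂ) :=
    LinearMap.pi (Sum.elim (fun j => Module.Dual.eval ℂ V (c j))
      fun _ => Module.Dual.eval ℂ V (ε⁻¹ • v))
  let x : Fin (Module.finrank ℂ C) ⊕ Unit → V := Sum.elim (fun i => c i) fun _ => u
  have hrow : ∀ i, ev ((b + ε • g) (x i)) = M ε i := by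
    have hbv : ∀ w, b w v = 0 := fun w => by
      rw [← hb.neg, LinearMap.mem_ker.1 hv]; simp
    intro i
    ext j
    rcases i with i | i <;> rcases j with j | j <;>
      simp [ev, x, M, hbv, LinearMap.mem_ker.1 hu, hε0]
  have hli : LinearIndependent ℂ fun i => (b + ε • g) (x i) := by
    refine LinearIndependent.of_comp ev ?_
    have : (ev ∘ fun i => (b + ε • g) (x i)) = (M ε).row := funext hrow
    rw [this, Matrix.linearIndependent_rows_iff_isUnit, Matrix.isUnit_iff_isUnit_det]
    exact hε.isUnit
  have h1 : Module.finrank ℂ C + 1 ≤ Module.finrank ℂ (LinearMap.range (b + ε • g)) := by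
    have h2 : LinearIndependent ℂ fun i =>
        (⟨(b + ε • g) (x i), x i, rfl⟩ : LinearMap.range (b + ε • g)) :=
      LinearIndependent.of_comp (LinearMap.range (b + ε • g)).subtype hli
    simpa using h2.fintype_card_le_finrank
  have h2 : Module.finrank ℂ (LinearMap.range b) = Module.finrank ℂ C := by
    have h3 := LinearMap.finrank_range_add_finrank_ker b
    have h4 := Submodule.finrank_add_eq_of_isCompl hC
    omega
  have h3 := hmax ε
  omega

/-- On a space of even dimension, a linear system of skew forms which do not all vanish at any pair
of independent vectors has a nondegenerate member. -/
lemma exists_nondegenerate (hV : Even (Module.finrank ℂ V))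
    (A : Submodule ℂ (V →ₗ[ℂ] V →ₗ[ℂ] ℂ)) (halt : ∀ b ∈ A, b.IsAlt)
    (hA : ∀ u v : V, LinearIndependent ℂ ![u, v] → ∃ b ∈ A, b u v ≠ 0) :
    ∃ b ∈ A, LinearMap.ker b = ⊥ := by
  -- a member of maximal rank
  obtain ⟨b, hbA, hmax⟩ : ∃ b ∈ A, ∀ b' ∈ A, Module.finrank ℂ (LinearMap.range b') ≤
      Module.finrank ℂ (LinearMap.range b) := by
    have hbd : ∀ b : V →ₗ[ℂ] V →ₗ[ℂ] ℂ, Module.finrank ℂ (LinearMap.range b) ≤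
      Module.finrank ℂ V := fun b => LinearMap.finrank_range_le b
    let s : Set ℕ := (fun b : V →ₗ[ℂ] V →ₗ[ℂ] ℂ => Module.finrank ℂ (LinearMap.range b)) '' A
    have hs : BddAbove s := ⟨Module.finrank ℂ V, by rintro _ ⟨b, -, rfl⟩; exact hbd b⟩
    obtain ⟨b, hb, hb'⟩ := Nat.sSup_mem (s := s) ⟨_, 0, A.zero_mem, rfl⟩ hs
    exact ⟨b, hb, fun b' h' => (le_csSup hs ⟨b', h', rfl⟩).trans hb'.ge⟩
  refine ⟨b, hbA, ?_⟩
  by_contra hker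
  obtain ⟨C, hC⟩ := Submodule.exists_isCompl (LinearMap.ker b)
  have h1 := even_finrank_compl (halt b hbA) hC
  have h2 := Submodule.finrank_add_eq_of_isCompl hC
  have h3 : Module.finrank ℂ (LinearMap.ker b) ≠ 0 := fun h =>
    hker (Submodule.finrank_eq_zero.1 h)
  have h4 : 1 < Module.finrank ℂ (LinearMap.ker b) := by
    rcases h1 with ⟨k, hk⟩; rcases hV with ⟨l, hl⟩; omega
  obtain ⟨w, hw⟩ := exists_linearIndependent_of_le_finrank (R := ℂ) h4
  have hw' : LinearIndependent ℂ ![(w 0 : V), (w 1 : V)] := by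
    have h5 := hw.map' (LinearMap.ker b).subtype (Submodule.ker_subtype _)
    have h6 : ![(w 0 : V), (w 1 : V)] = (LinearMap.ker b).subtype ∘ w := by
      ext i; fin_cases i <;> rfl
    rw [h6]
    exact h5
  obtain ⟨g, hg, hne⟩ := hA _ _ hw'
  exact hne (apply_eq_zero_of_maximal_rank (halt b hbA)
    (fun ε => hmax _ (A.add_mem hbA (A.smul_mem ε hg))) (w 0).2 (w 1).2)

end Skew

/-! ### Binary forms and their bivectors -/

section BinaryForms

open MvPolynomial

variable {n : ℕ}

lemma coef_mono (i : ℕ) (j : Fin (2 * n + 2)) :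
    coef n i (mono n j) = if i + j = 2 * n + 1 then 1 else 0 := by
  have h : (mono n j : MvPolynomial (Fin 2) ℂ) =
      monomial (Finsupp.single 0 (2 * n + 1 - (j : ℕ)) + Finsupp.single 1 (j : ℕ)) 1 := by
    simp [mono, X_pow_eq_monomial, monomial_mul]
  have hj := j.2
  change MvPolynomial.coeff _ (mono n j : MvPolynomial (Fin 2) ℂ) = _
  rw [h, coeff_monomial]
  refine if_congr ⟨fun h => ?_, fun h => ?_⟩ rfl rfl
  · have := DFunLike.congr_fun h 0
    simp at this
    omega
  · ext k
    fin_cases k <;> simp <;> omega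

lemma ext_coef {p q : S n} (h : ∀ i ≤ 2 * n + 1, coef n i p = coef n i q) : p = q := by
  refine Subtype.ext (MvPolynomial.ext _ _ fun d => ?_)
  by_cases hd : d 0 + d 1 = 2 * n + 1
  · have h1 : d = Finsupp.single 0 (d 0) + Finsupp.single 1 (2 * n + 1 - d 0) := by
      ext k
      fin_cases k <;> simp; omega
    rw [h1]
    exact h (d 0) (by omega)
  · have hdeg : d.degree ≠ 2 * n + 1 := by
      rwa [Finsupp.degree_eq_sum, Fin.sum_univ_two]
    rw [((mem_homogeneousSubmodule _ _).1 p.2).coeff_eq_zero hdeg,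
      ((mem_homogeneousSubmodule _ _).1 q.2).coeff_eq_zero hdeg]

lemma coef_sum (c : Fin (2 * n + 2) → ℂ) (k : Fin (2 * n + 2)) :
    coef n (2 * n + 1 - k) (∑ j, c j • mono n j) = c k := by
  have hk := k.2
  rw [map_sum, Finset.sum_eq_single k]
  · rw [LinearMap.map_smul, coef_mono, if_pos (by omega), smul_eq_mul, mul_one]
  · intro j _ hj
    rw [LinearMap.map_smul, coef_mono, if_neg, smul_zero]
    intro h
    exact hj (Fin.ext (by omega))
  · exact fun h => absurd (Finset.mem_univ k) h

variable (n) in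
/-- The basis `x^{2n+1-j} y^j` of the space of binary forms of degree `2n + 1`. -/
def monoBasis : Module.Basis (Fin (2 * n + 2)) ℂ (S n) :=
  Module.Basis.mk (v := mono n)
    (Fintype.linearIndependent_iff.2 fun c hc k => by
      rw [← coef_sum c k, hc, map_zero])
    (fun p _ => by
      have h : p = ∑ j : Fin (2 * n + 2), coef n (2 * n + 1 - j) p • mono n j :=
        ext_coef fun i hi => by
          have h1 := coef_sum (fun j : Fin (2 * n + 2) => coef n (2 * n + 1 - j) p)
            ⟨2 * n + 1 - i, by omega⟩
          have h2 : 2 * n + 1 - (2 * n + 1 - i) = i := by omega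
          simp only [h2] at h1
          exact h1.symm
      rw [h]
      exact Submodule.sum_mem _ fun j _ => Submodule.smul_mem _ _ (Submodule.subset_span ⟨j, rfl⟩))

@[simp] lemma monoBasis_apply (j : Fin (2 * n + 2)) : monoBasis n j = mono n j :=
  Module.Basis.mk_apply _ _ _

lemma finrank_S : Module.finrank ℂ (S n) = 2 * n + 2 := by
  rw [Module.finrank_eq_card_basis (monoBasis n), Fintype.card_fin]

lemma finrank_bivectors : Module.finrank ℂ (⋀[ℂ]^2 (S n)) = (2 * n + 2).choose 2 := by
  rw [exteriorPower.finrank_eq, finrank_S]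

/-- Linear maps on bivectors agree if they agree on the bivectors of pairs of monomials. -/
lemma bivector_hom_ext {M : Type*} [AddCommGroup M] [Module ℂ M] {A B : ⋀[ℂ]^2 (S n) →ₗ[ℂ] M}
    (h : ∀ i j, A (wedge (S n) (mono n i) (mono n j)) = B (wedge (S n) (mono n i) (mono n j))) :
    A = B := by
  apply exteriorPower.linearMap_ext
  refine Module.Basis.ext_alternating (monoBasis n) fun v _ => ?_
  have := h (v 0) (v 1)
  have hv : (fun i => monoBasis n (v i)) = ![mono n (v 0), mono n (v 1)] := by
    ext i : 1; fin_cases i <;> simp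
  rw [hv]
  exact this

lemma wedge_mono_ne_zero {i j : Fin (2 * n + 2)} (hij : i ≠ j) :
    wedge (S n) (mono n i) (mono n j) ≠ 0 := by
  intro h
  have hi : mono n i ≠ 0 := by rw [← monoBasis_apply]; exact (monoBasis n).ne_zero i
  obtain ⟨c, hc⟩ := exists_eq_smul_of_wedge_eq_zero hi h
  rw [← monoBasis_apply, ← monoBasis_apply] at hc
  have h1 := congr_arg (fun p => (monoBasis n).repr p j) hc
  simp [-monoBasis_apply, hij] at h1

lemma symp_mono_apply (i j : Fin (2 * n + 2)) : symp n (mono n i) (mono n j) =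
    if (i : ℕ) + j = 2 * n + 1 then
      (-1 : ℂ) ^ (j : ℕ) * (((j : ℕ).factorial : ℂ) * ((i : ℕ).factorial : ℂ)) else 0 := by
  have hi := i.2
  have hj := j.2
  simp only [symp, LinearMap.sum_apply, LinearMap.smulRight_apply, LinearMap.smul_apply]
  rw [Finset.sum_eq_single (2 * n + 1 - i)]
  · rw [coef_mono, coef_mono, if_pos (by omega)]
    split_ifs with h1 h2 h2
    · have e1 : 2 * n + 1 - (i : ℕ) = j := by omega
      have e2 : 2 * n + 1 - (j : ℕ) = i := by omega
      simp [e1, e2, mul_assoc]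
    · omega
    · omega
    · simp
  · intro k hk hne
    rw [Finset.mem_range] at hk
    rw [coef_mono, if_neg (by omega), zero_smul]
  · intro h
    exact absurd (Finset.mem_range.2 (by omega)) h

lemma symp_injective : Function.Injective (symp n) := by
  rw [injective_iff_map_eq_zero]
  intro u hu
  apply (monoBasis n).repr.injective
  ext i
  have h := LinearMap.congr_fun hu (mono n i.rev)
  rw [← (monoBasis n).sum_repr u, map_sum, LinearMap.sum_apply, Finset.sum_eq_single i] at h
  · rw [map_smul, LinearMap.smul_apply, monoBasis_apply, symp_mono_apply, if_pos
      (by rw [Fin.val_rev]; omega), smul_eq_mul, LinearMap.zero_apply] at h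
    simpa [Nat.factorial_ne_zero] using h
  · intro k _ hk
    rw [map_smul, LinearMap.smul_apply, monoBasis_apply, symp_mono_apply, if_neg, smul_zero]
    rw [Fin.val_rev]
    exact fun h => hk (Fin.ext (by omega))
  · simp

lemma pairing_bijective : Function.Bijective (pairing n) := by
  have h1 : Function.Surjective (symp n) :=
    (LinearMap.injective_iff_surjective_of_finrank_eq_finrank
      Subspace.dual_finrank_eq.symm).1 symp_injective
  have h2 : Function.Surjective (exteriorPower.pairingDual ℂ (S n) 2) := by
    rw [← LinearMap.range_eq_top, eq_top_iff, ← ((monoBasis n).exteriorPower 2).dualBasis.span_eq,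
      Submodule.span_le]
    rintro _ ⟨s, rfl⟩
    rw [Module.Basis.coe_dualBasis, exteriorPower.basis_coord]
    exact ⟨_, rfl⟩
  have h3 : Function.Surjective (pairing n) := h2.comp (exteriorPower.map_surjective h1)
  exact ⟨(LinearMap.injective_iff_surjective_of_finrank_eq_finrank
    Subspace.dual_finrank_eq.symm).2 h3, h3⟩

lemma pairing_wedge (a b c d : S n) : pairing n (wedge (S n) a b) (wedge (S n) c d) =
    symp n a c * symp n b d - symp n a d * symp n b c := by
  have h1 : exteriorPower.map 2 (symp n) (wedge (S n) a b) =
      exteriorPower.ιMulti ℂ 2 ![symp n a, symp n b] := by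
    refine (exteriorPower.map_apply_ιMulti (symp n) ![a, b]).trans ?_
    congr 1
    ext i : 1; fin_cases i <;> rfl
  have h2 := exteriorPower.pairingDual_ιMulti_ιMulti (R := ℂ) ![symp n a, symp n b] ![c, d]
  rw [Matrix.det_fin_two] at h2
  have h3 : pairing n (wedge (S n) a b) (wedge (S n) c d) =
      exteriorPower.pairingDual ℂ (S n) 2 (exteriorPower.ιMulti ℂ 2 ![symp n a, symp n b])
        (exteriorPower.ιMulti ℂ 2 ![c, d]) := by
    rw [← h1]; rfl
  rw [h3, h2]
  simp only [Matrix.of_apply, Matrix.cons_val_zero, Matrix.cons_val_one]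
  ring

lemma diag_mono (a b : ℂ) (j : Fin (2 * n + 2)) :
    diag n a b (mono n j) = (a ^ (2 * n + 1 - (j : ℕ)) * b ^ (j : ℕ)) • mono n j := by
  have h1 : (diag n a b (mono n j) : MvPolynomial (Fin 2) ℂ) =
      aeval (R := ℂ) ![C a * X 0, C b * (X 1 : MvPolynomial (Fin 2) ℂ)]
        (X 0 ^ (2 * n + 1 - (j : ℕ)) * X 1 ^ (j : ℕ)) := rfl
  have h2 : ((mono n j : S n) : MvPolynomial (Fin 2) ℂ) =
    X 0 ^ (2 * n + 1 - (j : ℕ)) * X 1 ^ (j : ℕ) := rfl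
  refine Subtype.ext ?_
  rw [h1, Submodule.coe_smul, h2, smul_eq_C_mul]
  simp only [map_mul, map_pow, aeval_X, Matrix.cons_val_zero, Matrix.cons_val_one, mul_pow]
  ring

end BinaryForms

/-! ### Weights of the torus action -/

section Weights

open Polynomial

variable {n : ℕ} {α : ℕ} {β : ℤ}

lemma act_wedge (t : ℂˣ) (u v : S n) : act n α β t (wedge (S n) u v) =
    wedge (S n) (diag n ((t ^ α : ℂˣ) : ℂ) ((t ^ β : ℂˣ) : ℂ) u)
      (diag n ((t ^ α : ℂˣ) : ℂ) ((t ^ β : ℂˣ) : ℂ) v) := by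
  refine (exteriorPower.map_apply_ιMulti _ ![u, v]).trans ?_
  refine congr_arg (exteriorPower.ιMulti ℂ 2) ?_
  ext i : 1
  fin_cases i <;> rfl

/-- The weight of the bivectors `x^{m-i} y^i ∧ x^{m-j} y^j` with `i + j = k`, where `m = 2n + 1`. -/
def wt (n : ℕ) (α : ℕ) (β : ℤ) (k : ℕ) : ℤ := 2 * (2 * n + 1) * α - (α - β) * k

lemma act_wedge_mono (t : ℂˣ) (i j : Fin (2 * n + 2)) :
    act n α β t (wedge (S n) (mono n i) (mono n j)) =
      ((t ^ wt n α β (i + j) : ℂˣ) : ℂ) • wedge (S n) (mono n i) (mono n j) := by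
  rw [act_wedge, diag_mono, diag_mono, map_smul, LinearMap.map_smul₂, smul_smul]
  congr 1
  simp only [← Units.val_pow_eq_pow_val, ← Units.val_mul]
  congr 1
  have hi := i.2
  have hj := j.2
  simp only [← zpow_natCast, ← zpow_mul, ← zpow_add]
  congr 1
  rw [wt, Nat.cast_sub (by omega), Nat.cast_sub (by omega)]
  push_cast
  ring

/-- The scalar `2`, which is not a root of unity. -/
def two : ℂˣ := Units.mk0 2 two_ne_zero

lemma two_zpow_injective : Function.Injective fun w : ℤ => ((two ^ w : ℂˣ) : ℂ) := by
  intro a b h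
  simp only [two, Units.val_zpow_eq_zpow_val, Units.val_mk0] at h
  have h1 : ((2 : ℝ) ^ a : ℝ) = (2 : ℝ) ^ b := Complex.ofReal_injective (by push_cast; exact h)
  exact zpow_right_injective₀ (by norm_num) (by norm_num) h1

lemma wt_injective (hβ : β < α) : Function.Injective (wt n α β) := by
  intro k l h
  have h1 : ((α : ℤ) - β) * (k - l) = 0 := by
    simp only [wt] at h
    linear_combination -h
  rcases mul_eq_zero.1 h1 with h2 | h2 <;> omega

lemma aeval_act_wedge_mono (p : ℂ[X]) (i j : Fin (2 * n + 2)) :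
    aeval (R := ℂ) (A := Module.End ℂ (⋀[ℂ]^2 (S n))) (act n α β two) p
        (wedge (S n) (mono n i) (mono n j)) =
      p.eval ((two ^ wt n α β (i + j) : ℂˣ) : ℂ) • wedge (S n) (mono n i) (mono n j) := by
  induction p using Polynomial.induction_on with
  | C a => simp
  | add p q hp hq => rw [map_add, LinearMap.add_apply, hp, hq, eval_add, add_smul]
  | monomial k a h =>
    rw [pow_succ', ← mul_assoc, mul_comm (C a), mul_assoc, map_mul, Module.End.mul_apply, h,
      map_smul, aeval_X, act_wedge_mono, smul_smul, mul_comm X, eval_mul_X]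

/-- Every operator which is scalar on the weight spaces is a polynomial in the action of `2`. -/
lemma exists_aeval_act_eq (hβ : β < α) (g : ℕ → ℂ) : ∃ p : ℂ[X], ∀ i j,
    aeval (R := ℂ) (A := Module.End ℂ (⋀[ℂ]^2 (S n))) (act n α β two) p
      (wedge (S n) (mono n i) (mono n j)) = g (i + j) • wedge (S n) (mono n i) (mono n j) := by
  refine ⟨Lagrange.interpolate (Finset.range (4 * n + 3))
    (fun k => ((two ^ wt n α β k : ℂˣ) : ℂ)) g, fun i j => ?_⟩
  have hi := i.2
  have hj := j.2
  have h := Lagrange.eval_interpolate_at_node (s := Finset.range (4 * n + 3)) g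
    (two_zpow_injective.comp (wt_injective (n := n) hβ)).injOn
    (Finset.mem_range.2 (show (i : ℕ) + j < 4 * n + 3 by omega))
  exact (aeval_act_wedge_mono _ i j).trans (congr_arg (· • _) h)

lemma isInvariant_of_map_two_le (hβ : β < α) {P : Submodule ℂ (⋀[ℂ]^2 (S n))}
    (h : P.map (act n α β two) ≤ P) : IsInvariant α β P := by
  rintro t _ ⟨x, hx, rfl⟩
  obtain ⟨p, hp⟩ := exists_aeval_act_eq (n := n) hβ fun k => ((t ^ wt n α β k : ℂˣ) : ℂ)
  have h1 : act n α β t = aeval (R := ℂ) (A := Module.End ℂ (⋀[ℂ]^2 (S n))) (act n α β two) p :=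
    bivector_hom_ext fun i j => by rw [act_wedge_mono, hp]
  rw [h1]
  exact aeval_apply_smul_mem_of_le_comap hx p _ (Submodule.map_le_iff_le_comap.1 h)

/-- If `α = β`, the torus acts by scalars. -/
lemma act_eq_smul (hβ : β = α) (t : ℂˣ) :
    act n α β t = ((t ^ wt n α β 0 : ℂˣ) : ℂ) • LinearMap.id :=
  bivector_hom_ext fun i j => by
    rw [act_wedge_mono, LinearMap.smul_apply, LinearMap.id_apply]
    simp [wt, hβ]

/-- The torus action is semisimple. -/
lemma exists_isInvariant_isCompl (hβ : β ≤ α) {P : Submodule ℂ (⋀[ℂ]^2 (S n))}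
    (hP : IsInvariant α β P) : ∃ D, IsInvariant α β D ∧ IsCompl P D := by
  rcases hβ.eq_or_lt with h | h
  · obtain ⟨D, hD⟩ := Submodule.exists_isCompl P
    refine ⟨D, ?_, hD⟩
    rintro t _ ⟨x, hx, rfl⟩
    rw [act_eq_smul h]
    exact D.smul_mem _ hx
  · have hss : (show Module.End ℂ (⋀[ℂ]^2 (S n)) from act n α β two).IsSemisimple := by
      refine Module.End.isSemisimple_of_squarefree_aeval_eq_zero
        (p := ∏ k : Fin (4 * n + 3), (X - C ((two ^ wt n α β k : ℂˣ) : ℂ))) ?_ ?_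
      · refine Separable.squarefree (separable_prod_X_sub_C_iff.2 ?_)
        exact (two_zpow_injective.comp (wt_injective h)).comp Fin.val_injective
      · refine bivector_hom_ext fun i j => ?_
        have hi := i.2
        have hj := j.2
        refine (aeval_act_wedge_mono _ i j).trans ?_
        rw [eval_prod, Finset.prod_eq_zero (Finset.mem_univ ⟨i + j, by omega⟩) (by simp), zero_smul]
        rfl
    obtain ⟨D, hD, hc⟩ := Module.End.isSemisimple_iff.1 hss P fun x hx => hP two ⟨x, hx, rfl⟩
    exact ⟨D, isInvariant_of_map_two_le h (by rintro _ ⟨x, hx, rfl⟩; exact hD hx), hc⟩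

end Weights

/-! ### Skew forms orthogonal to a Tango subspace -/

section Tango

variable {n : ℕ} {α : ℕ} {β : ℤ} {W : Submodule ℂ (⋀[ℂ]^2 (S n))}

/-- The skew form `ω` is supported on the pairs of monomials `x^{m-i} y^i`, `x^{m-j} y^j` with
`i + j = k`: its matrix is concentrated on one antidiagonal. -/
def IsWeightForm (k : ℕ) (ω : Module.Dual ℂ (⋀[ℂ]^2 (S n))) : Prop :=
  ∀ i j : Fin (2 * n + 2), (i : ℕ) + j ≠ k → ω (wedge (S n) (mono n i) (mono n j)) = 0

lemma IsWeightForm.comp_act {k : ℕ} {ω : Module.Dual ℂ (⋀[ℂ]^2 (S n))} (h : IsWeightForm k ω)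
    (t : ℂˣ) : ω.comp (act n α β t) = ((t ^ wt n α β k : ℂˣ) : ℂ) • ω :=
  bivector_hom_ext fun i j => by
    rw [LinearMap.comp_apply, act_wedge_mono, map_smul, LinearMap.smul_apply]
    by_cases hk : (i : ℕ) + j = k
    · rw [hk]
    · rw [h i j hk, smul_zero, smul_zero]

/-- Every weight space contains a nonzero decomposable bivector, which is not in `W`. Hence there is
a nonzero form orthogonal to `W` of each weight. -/
lemma exists_isWeightForm (hβ : β < α) (hW : IsTango α β W) {k : ℕ} (h1 : 1 ≤ k)
    (h2 : k ≤ 4 * n + 1) : ∃ φ : Module.Dual ℂ (⋀[ℂ]^2 (S n)),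
      IsWeightForm k φ ∧ W ≤ LinearMap.ker φ ∧ φ ≠ 0 := by
  obtain ⟨i, j, hij, hk⟩ : ∃ i j : Fin (2 * n + 2), i ≠ j ∧ (i : ℕ) + j = k := by
    by_cases h : k ≤ 2 * n + 1
    · refine ⟨⟨0, by omega⟩, ⟨k, by omega⟩, fun h' => ?_, by simp⟩
      have := Fin.val_eq_of_eq h'
      simp only at this; omega
    · refine ⟨⟨k - (2 * n + 1), by omega⟩, ⟨2 * n + 1, by omega⟩, fun h' => ?_, by simp only; omega⟩
      have := Fin.val_eq_of_eq h'
      simp only at this; omega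
  obtain ⟨φ, hφ, hWφ⟩ := Submodule.exists_le_ker_of_notMem
    fun h => wedge_mono_ne_zero hij (hW.decomposable _ _ h)
  -- restriction of `φ` to the weight space
  obtain ⟨p, hp⟩ := exists_aeval_act_eq (n := n) hβ fun l => if l = k then 1 else 0
  let π : Module.End ℂ (⋀[ℂ]^2 (S n)) :=
    Polynomial.aeval (R := ℂ) (A := Module.End ℂ (⋀[ℂ]^2 (S n))) (act n α β two) p
  refine ⟨φ ∘ₗ π, fun a b hab => ?_, fun w hw => hWφ ?_, fun h => hφ ?_⟩
  · rw [LinearMap.comp_apply, hp, if_neg hab, zero_smul, map_zero]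
  · exact Polynomial.aeval_apply_smul_mem_of_le_comap hw p _
      (Submodule.map_le_iff_le_comap.1 (hW.invariant two))
  · have h3 := LinearMap.congr_fun h (wedge (S n) (mono n i) (mono n j))
    rw [LinearMap.comp_apply, hp, if_pos hk, one_smul] at h3
    exact h3

/-- There are as many weights as the codimension of a Tango subspace, so that the forms orthogonal
to it have a basis with one form of each weight. -/
lemma exists_weight_basis (hβ : β < α) (hW : IsTango α β W) :
    ∃ φ : Fin (4 * n + 1) → Module.Dual ℂ (⋀[ℂ]^2 (S n)),
      (∀ k : Fin (4 * n + 1), IsWeightForm ((k : ℕ) + 1) (φ k)) ∧ (∀ k, W ≤ LinearMap.ker (φ k)) ∧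
      LinearIndependent ℂ φ ∧ ∀ ψ : Module.Dual ℂ (⋀[ℂ]^2 (S n)), W ≤ LinearMap.ker ψ →
        ∃ c : Fin (4 * n + 1) → ℂ, ψ = ∑ k, c k • φ k := by
  have h : ∀ k : Fin (4 * n + 1), ∃ φ : Module.Dual ℂ (⋀[ℂ]^2 (S n)),
      IsWeightForm (k + 1) φ ∧ W ≤ LinearMap.ker φ ∧ φ ≠ 0 :=
    fun k => exists_isWeightForm hβ hW (by omega) (by omega)
  choose φ hφ hWφ h0 using h
  have hli : LinearIndependent ℂ φ := by
    refine Module.End.eigenvectors_linearIndependent' (LinearMap.dualMap (act n α β two))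
      (fun k : Fin (4 * n + 1) => ((two ^ wt n α β ((k : ℕ) + 1) : ℂˣ) : ℂ)) ?_ φ fun k => ?_
    · intro k l hkl
      have := wt_injective hβ (two_zpow_injective hkl)
      exact Fin.ext (by omega)
    · exact ⟨Module.End.mem_eigenspace_iff.2 ((hφ k).comp_act two), h0 k⟩
  refine ⟨φ, hφ, hWφ, hli, fun ψ hψ => ?_⟩
  have hspan : Submodule.span ℂ (Set.range φ) = W.dualAnnihilator := by
    refine Submodule.eq_of_le_of_finrank_eq ?_ ?_
    · rw [Submodule.span_le]
      rintro _ ⟨k, rfl⟩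
      exact (Submodule.mem_dualAnnihilator _).2 fun w hw => hWφ k hw
    · rw [finrank_span_eq_card hli, Fintype.card_fin]
      have h1 := Subspace.finrank_add_finrank_dualAnnihilator_eq W
      rw [finrank_bivectors, ← hW.finrank_eq] at h1
      omega
  have hmem : ψ ∈ Submodule.span ℂ (Set.range φ) :=
    hspan ▸ (Submodule.mem_dualAnnihilator _).2 fun w hw => hψ hw
  obtain ⟨c, hc⟩ := (Submodule.mem_span_range_iff_exists_fun ℂ).1 hmem
  exact ⟨c, hc.symm⟩

/-- A form of weight `2n + 1` with nonzero antidiagonal entries is nondegenerate. -/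
lemma IsWeightForm.nondegenerate {ω : Module.Dual ℂ (⋀[ℂ]^2 (S n))}
    (h : IsWeightForm (2 * n + 1) ω)
    (h0 : ∀ i j : Fin (2 * n + 2), (i : ℕ) + j = 2 * n + 1 →
      ω (wedge (S n) (mono n i) (mono n j)) ≠ 0)
    (u : S n) (hu : ∀ v, ω (wedge (S n) u v) = 0) : u = 0 := by
  apply (monoBasis n).repr.injective
  ext i
  have h1 := hu (mono n i.rev)
  have hi : (i : ℕ) + i.rev = 2 * n + 1 := by rw [Fin.val_rev]; omega
  rw [← (monoBasis n).sum_repr u, map_sum, LinearMap.sum_apply, map_sum,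
    Finset.sum_eq_single i] at h1
  · rw [map_smul, LinearMap.smul_apply, map_smul, monoBasis_apply, smul_eq_mul] at h1
    simpa using (mul_eq_zero.1 h1).resolve_right (h0 _ _ hi)
  · intro k _ hk
    rw [map_smul, LinearMap.smul_apply, map_smul, monoBasis_apply, h, smul_zero]
    exact fun h' => hk (Fin.ext (by omega))
  · exact fun h' => absurd (Finset.mem_univ i) h'

/-- A nondegenerate form of weight `k` exists only for `k = 2n + 1`. -/
lemma IsWeightForm.eq_of_nondegenerate {k : ℕ} {ω : Module.Dual ℂ (⋀[ℂ]^2 (S n))}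
    (h : IsWeightForm k ω) (hω : ∀ u, (∀ v, ω (wedge (S n) u v) = 0) → u = 0) :
    k = 2 * n + 1 := by
  by_contra hk
  -- the row of an index without partner on the antidiagonal of `k` vanishes
  obtain ⟨i, hi⟩ : ∃ i : Fin (2 * n + 2), ∀ j : Fin (2 * n + 2), (i : ℕ) + j ≠ k := by
    rcases lt_or_gt_of_ne hk with h | h
    · exact ⟨Fin.last _, fun j => by simp; omega⟩
    · exact ⟨0, fun j => by simp; omega⟩
  refine (monoBasis n).ne_zero i (hω _ fun v => ?_)
  rw [← (monoBasis n).sum_repr v, map_sum, map_sum]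
  refine Finset.sum_eq_zero fun j _ => ?_
  rw [map_smul, map_smul, monoBasis_apply, monoBasis_apply, h i j (hi j), smul_zero]

lemma IsAdapted.pairing_ne_zero {f : ⋀[ℂ]^2 (S n)} (hf : IsAdapted α β W f) :
    pairing n f ≠ 0 := fun h => by
  refine (monoBasis n).ne_zero 0 (hf.nondegenerate _ fun v => ?_)
  rw [h, LinearMap.zero_apply]

/-- For `α > β` there is, up to scalars, one nondegenerate semi-invariant form orthogonal to `W`;
its matrix is antidiagonal. -/
lemma exists_special_form (hβ : β < α) (hW : IsTango α β W) :
    ∃ φ : Module.Dual ℂ (⋀[ℂ]^2 (S n)), IsWeightForm (2 * n + 1) φ ∧ W ≤ LinearMap.ker φ ∧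
      (∀ i j : Fin (2 * n + 2), (i : ℕ) + j = 2 * n + 1 →
        φ (wedge (S n) (mono n i) (mono n j)) ≠ 0) ∧
      ∀ f : ⋀[ℂ]^2 (S n), IsAdapted α β W f → ∃ c : ℂ, c ≠ 0 ∧ pairing n f = c • φ := by
  obtain ⟨φ, hφ, hWφ, hli, hspan⟩ := exists_weight_basis hβ hW
  let k₀ : Fin (4 * n + 1) := ⟨2 * n, by omega⟩
  refine ⟨φ k₀, hφ k₀, hWφ k₀, fun i j hij h0 => ?_, fun f hf => ?_⟩
  · have hne : i ≠ j := by rintro rfl; omega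
    obtain ⟨ψ, hψ, hWψ⟩ := Submodule.exists_le_ker_of_notMem
      fun h => wedge_mono_ne_zero hne (hW.decomposable _ _ h)
    obtain ⟨c, rfl⟩ := hspan ψ hWψ
    apply hψ
    rw [LinearMap.sum_apply]
    refine Finset.sum_eq_zero fun k _ => ?_
    rw [LinearMap.smul_apply]
    by_cases hk : k = k₀
    · rw [hk, h0, smul_zero]
    · rw [hφ k i j, smul_zero]
      exact fun h => hk (Fin.ext (by simp only [k₀]; omega))
  · obtain ⟨c, hc⟩ := hspan (pairing n f) fun w hw => hf.orthogonal w hw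
    obtain ⟨k, hk⟩ : ∃ k, c k ≠ 0 := by
      by_contra! h
      exact hf.pairing_ne_zero (by rw [hc]; simp [h])
    -- a semi-invariant form has only one weight
    obtain ⟨a, ha⟩ := hf.semiInvariant two
    have hcoef : ∀ l, c l * ((two ^ wt n α β (l + 1) : ℂˣ) : ℂ) = a * c l := by
      have h1 : ∑ l, (c l * ((two ^ wt n α β (l + 1) : ℂˣ) : ℂ) - a * c l) • φ l = 0 := by
        rw [hc] at ha
        simp only [sub_smul, Finset.sum_sub_distrib, mul_smul, ← Finset.smul_sum]
        have h2 : (∑ l, c l • φ l) ∘ₗ act n α β two = ∑ l, c l • (φ l ∘ₗ act n α β two) :=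
          LinearMap.ext fun x => by simp [LinearMap.sum_apply]
        rw [← ha, sub_eq_zero, h2]
        exact Finset.sum_congr rfl fun l _ => by rw [(hφ l).comp_act]
      exact fun l => sub_eq_zero.1 (Fintype.linearIndependent_iff.1 hli _ h1 l)
    have hsingle : ∀ l, l ≠ k → c l = 0 := fun l hl => by
      by_contra h
      have e1 : ((two ^ wt n α β (l + 1) : ℂˣ) : ℂ) = a :=
        mul_left_cancel₀ h ((hcoef l).trans (mul_comm _ _))
      have e2 : ((two ^ wt n α β (k + 1) : ℂˣ) : ℂ) = a :=
        mul_left_cancel₀ hk ((hcoef k).trans (mul_comm _ _))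
      have := wt_injective hβ (two_zpow_injective (e1.trans e2.symm))
      exact hl (Fin.ext (by omega))
    have hfk : pairing n f = c k • φ k := by
      rw [hc, Finset.sum_eq_single k (fun l _ hl => by rw [hsingle l hl, zero_smul])
        (fun h => absurd (Finset.mem_univ k) h)]
    have hw : IsWeightForm (k + 1) (pairing n f) := fun i j hij => by
      rw [hfk, LinearMap.smul_apply, hφ k i j hij, smul_zero]
    have hk₀ : k = k₀ := Fin.ext (by
      have := hw.eq_of_nondegenerate hf.nondegenerate
      simp only [k₀]; omega)
    exact ⟨c k, hk, by rw [hfk, hk₀]⟩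

/-- If `α = β`, every form is semi-invariant, and the forms orthogonal to `W` vanish at no
decomposable bivector. -/
lemma exists_isAdapted_of_eq (hβ : β = α) (hW : IsTango α β W) : ∃ f, IsAdapted α β W f := by
  let A : Submodule ℂ (S n →ₗ[ℂ] S n →ₗ[ℂ] ℂ) :=
    { carrier := {b | ∃ ω : Module.Dual ℂ (⋀[ℂ]^2 (S n)), W ≤ LinearMap.ker ω ∧
        (wedge (S n)).compr₂ ω = b}
      zero_mem' := ⟨0, by simp, by ext; simp⟩
      add_mem' := by
        rintro _ _ ⟨ω, h, rfl⟩ ⟨ω', h', rfl⟩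
        exact ⟨ω + ω',
          fun w hw => by simp [LinearMap.mem_ker.1 (h hw), LinearMap.mem_ker.1 (h' hw)],
          by ext; simp⟩
      smul_mem' := by
        rintro c _ ⟨ω, h, rfl⟩
        exact ⟨c • ω, fun w hw => by simp [LinearMap.mem_ker.1 (h hw)], by ext; simp⟩ }
  obtain ⟨_, ⟨ω, hWω, rfl⟩, hker⟩ := exists_nondegenerate (V := S n)
    (by rw [finrank_S]; exact ⟨n + 1, by ring⟩) A
    (by rintro _ ⟨ω, -, rfl⟩ v; simp [wedge_self])
    (fun u v huv => by
      have hne : wedge (S n) u v ≠ 0 := fun h => by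
        obtain ⟨c, hc⟩ := exists_eq_smul_of_wedge_eq_zero (huv.ne_zero 0) h
        exact (LinearIndependent.pair_iff' (huv.ne_zero 0)).1 huv c hc.symm
      obtain ⟨ω, hω, hWω⟩ := Submodule.exists_le_ker_of_notMem
        fun h => hne (hW.decomposable _ _ h)
      exact ⟨_, ⟨ω, hWω, rfl⟩, hω⟩)
  obtain ⟨f, rfl⟩ := pairing_bijective.2 ω
  refine ⟨f, fun u hu => ?_, fun t => ⟨t ^ wt n α β 0, ?_⟩, fun w hw => hWω hw⟩
  · rw [← Submodule.mem_bot ℂ, ← hker, LinearMap.mem_ker]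
    ext v
    exact hu v
  · rw [act_eq_smul hβ, LinearMap.comp_smul, LinearMap.comp_id]

lemma exists_isAdapted (hβ : β ≤ α) (hW : IsTango α β W) : ∃ f, IsAdapted α β W f := by
  rcases hβ.eq_or_lt with h | h
  · exact exists_isAdapted_of_eq h hW
  · obtain ⟨φ, hφ, hWφ, h0, -⟩ := exists_special_form h hW
    obtain ⟨f, rfl⟩ := pairing_bijective.2 φ
    exact ⟨f, hφ.nondegenerate h0, fun t => ⟨_, hφ.comp_act t⟩, fun w hw => hWφ hw⟩

end Tango

/-! ### Invariant complements -/

section Complement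

variable {n : ℕ} {α : ℕ} {β : ℤ} {W : Submodule ℂ (⋀[ℂ]^2 (S n))}

lemma symp_diag (a b : ℂ) (u v : S n) :
    symp n (diag n a b u) (diag n a b v) = (a * b) ^ (2 * n + 1) * symp n u v := by
  have h : (symp n).compl₁₂ (diag n a b) (diag n a b) = ((a * b) ^ (2 * n + 1)) • symp n := by
    refine LinearMap.ext_basis (monoBasis n) (monoBasis n) fun i j => ?_
    simp only [monoBasis_apply, LinearMap.compl₁₂_apply, diag_mono, map_smul,
      LinearMap.smul_apply, symp_mono_apply, smul_eq_mul]
    split_ifs with hij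
    · have h1 : 2 * n + 1 - (i : ℕ) = j := by omega
      have h2 : 2 * n + 1 - (j : ℕ) = i := by omega
      rw [h1, h2, ← hij]
      ring
    · simp
  exact LinearMap.congr_fun₂ h u v

/-- The torus preserves the symmetric form on bivectors up to scalars. -/
lemma pairing_act (t : ℂˣ) : ∃ d : ℂ, ∀ x y : ⋀[ℂ]^2 (S n),
    pairing n (act n α β t x) (act n α β t y) = d * pairing n x y := by
  set a := ((t ^ α : ℂˣ) : ℂ) with ha
  set b := ((t ^ β : ℂˣ) : ℂ) with hb
  refine ⟨((a * b) ^ (2 * n + 1)) ^ 2, fun x y => ?_⟩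
  have h : (pairing n).compl₁₂ (act n α β t) (act n α β t) =
      (((a * b) ^ (2 * n + 1)) ^ 2) • pairing n := by
    refine bivector_hom_ext fun i j => bivector_hom_ext fun k l => ?_
    simp only [LinearMap.compl₁₂_apply, act_wedge, LinearMap.smul_apply, smul_eq_mul, pairing_wedge,
      symp_diag]
    ring
  exact LinearMap.congr_fun₂ h x y

lemma act_act_inv (t : ℂˣ) (x : ⋀[ℂ]^2 (S n)) : act n α β t (act n α β t⁻¹ x) = x := by
  have h : act n α β t ∘ₗ act n α β t⁻¹ = LinearMap.id := bivector_hom_ext fun i j => by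
    rw [LinearMap.comp_apply, act_wedge_mono, map_smul, act_wedge_mono, smul_smul, ← Units.val_mul,
      inv_zpow, inv_mul_cancel, Units.val_one, one_smul, LinearMap.id_apply]
  exact LinearMap.congr_fun h x

/-- If the linear form `⟨f, ·⟩` is semi-invariant, then so is the line of `f`. -/
lemma IsAdapted.isInvariant_span {f : ⋀[ℂ]^2 (S n)} (hf : IsAdapted α β W f) :
    IsInvariant α β (Submodule.span ℂ {f}) := by
  rintro t _ ⟨x, hx, rfl⟩
  obtain ⟨c, rfl⟩ := Submodule.mem_span_singleton.1 hx
  obtain ⟨d, hd⟩ := pairing_act (n := n) (α := α) (β := β) t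
  obtain ⟨a, ha⟩ := hf.semiInvariant t⁻¹
  have h : act n α β t f = (d * a) • f := by
    refine pairing_bijective.1 (LinearMap.ext fun y => ?_)
    rw [← act_act_inv (α := α) (β := β) t y, hd, act_act_inv]
    have := LinearMap.congr_fun ha y
    rw [LinearMap.comp_apply] at this
    rw [this, map_smul, LinearMap.smul_apply, LinearMap.smul_apply, smul_eq_mul, smul_eq_mul,
      mul_assoc]
  rw [map_smul, h]
  exact Submodule.smul_mem _ _ (Submodule.smul_mem _ _ (Submodule.mem_span_singleton_self f))

lemma IsInvariant.sup {P P' : Submodule ℂ (⋀[ℂ]^2 (S n))} (h : IsInvariant α β P)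
    (h' : IsInvariant α β P') : IsInvariant α β (P ⊔ P') := fun t => by
  rw [Submodule.map_sup]
  exact sup_le_sup (h t) (h' t)

lemma IsAdapted.exists_isInvariant_isCompl (hβ : β ≤ α) (hW : IsInvariant α β W)
    {f : ⋀[ℂ]^2 (S n)} (hf : IsAdapted α β W f) :
    ∃ D, IsInvariant α β D ∧ IsCompl D W ∧ (f ∉ W → f ∈ D) := by
  by_cases hfW : f ∈ W
  · obtain ⟨D, hD, hc⟩ := ProjBundle.exists_isInvariant_isCompl hβ hW
    exact ⟨D, hD, hc.symm, fun h => absurd hfW h⟩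
  · obtain ⟨D, hD, hc⟩ := ProjBundle.exists_isInvariant_isCompl hβ (hW.sup hf.isInvariant_span)
    have hdisj : Disjoint W (Submodule.span ℂ {f}) := by
      rw [Submodule.disjoint_span_singleton]
      exact fun h => absurd h hfW
    refine ⟨Submodule.span ℂ {f} ⊔ D, hf.isInvariant_span.sup hD, IsCompl.symm ⟨?_, ?_⟩,
      fun _ => Submodule.mem_sup_left (Submodule.mem_span_singleton_self f)⟩
    · exact hdisj.disjoint_sup_right_of_disjoint_sup_left hc.disjoint
    · rw [codisjoint_iff, ← sup_assoc]
      exact hc.sup_eq_top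

end Complement

section Models

variable {M : Type} [AddCommGroup M] [Module ℂ M] [FiniteDimensional ℂ M]

/-- A complement `D` of `W` identifies the kernel of `ω` on `D` with the kernel of the form induced
by `ω` on `M / W`. -/
def kerEquiv {D W : Submodule ℂ M} (h : IsCompl D W) {ω : Module.Dual ℂ M}
    (hω : W ≤ LinearMap.ker ω) :
    (D ⊓ LinearMap.ker ω : Submodule ℂ M) ≃ₗ[ℂ] LinearMap.ker (W.liftQ ω hω) :=
  LinearEquiv.ofBijective
    (LinearMap.codRestrict _ (W.mkQ ∘ₗ (D ⊓ LinearMap.ker ω).subtype) fun x => by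
      simpa using x.2.2)
    (by
      constructor
      · rw [injective_iff_map_eq_zero]
        intro x hx
        have h1 : (x : M) ∈ W := (Submodule.Quotient.mk_eq_zero W).1 (congr_arg Subtype.val hx)
        exact Subtype.ext (Submodule.disjoint_def.1 h.disjoint _ x.2.1 h1)
      · rintro ⟨y, hy⟩
        obtain ⟨z, rfl⟩ := W.mkQ_surjective y
        obtain ⟨d, hd, w, hw, rfl⟩ := Submodule.mem_sup.1
          (show z ∈ D ⊔ W from h.sup_eq_top ▸ Submodule.mem_top)
        have h1 : ω w = 0 := hω hw
        refine ⟨⟨d, hd, by simpa [h1] using hy⟩, Subtype.ext ?_⟩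
        simp [(Submodule.Quotient.mk_eq_zero W).2 hw])

/-- The quotient `D / ℂ f` has the dimension of the kernel of the form induced by `ω` on
`M / W`, both having codimension one. -/
lemma finrank_modLine {D W : Submodule ℂ M} (h : IsCompl D W) {ω : Module.Dual ℂ M}
    (hω : W ≤ LinearMap.ker ω) (hω0 : ω ≠ 0) {f : M} (hf : f ∈ D) (hf0 : f ≠ 0) :
    Module.finrank ℂ (modLine D f) = Module.finrank ℂ (LinearMap.ker (W.liftQ ω hω)) := by
  have h1 : Module.finrank ℂ ((Submodule.span ℂ {f}).comap D.subtype) = 1 := by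
    rw [(Submodule.comapSubtypeEquivOfLe
      ((Submodule.span_singleton_le_iff_mem f D).2 hf)).finrank_eq, finrank_span_singleton hf0]
  have h2 := Submodule.finrank_quotient_add_finrank ((Submodule.span ℂ {f}).comap D.subtype)
  have h3 : Module.finrank ℂ (LinearMap.range (W.liftQ ω hω)) = 1 := by
    rw [Submodule.range_liftQ, LinearMap.range_eq_top.2 (LinearMap.surjective hω0), finrank_top,
      Module.finrank_self]
  have h4 := LinearMap.finrank_range_add_finrank_ker (W.liftQ ω hω)
  have h5 := (Submodule.quotientEquivOfIsCompl W D h.symm).finrank_eq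
  change Module.finrank ℂ (D ⧸ _) = _
  omega

end Models

end ProjBundle

end

theorem mainTheorem5 (n : ℕ) (hn : 0 < n) (α : ℕ) (β : ℤ) (hβ : β ≤ α)
    (W : Submodule ℂ (⋀[ℂ]^2 (S n))) (hW : IsTango α β W) :
    (∃ f : ⋀[ℂ]^2 (S n), IsAdapted α β W f) ∧
    (β < α → ∀ f f' : ⋀[ℂ]^2 (S n), IsAdapted α β W f → IsAdapted α β W f' →
      ∃ c : ℂ, c ≠ 0 ∧ f' = c • f) ∧
    (β < α → ∀ f : ⋀[ℂ]^2 (S n), IsAdapted α β W f → IsSpecial f) ∧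
    ∀ f : ⋀[ℂ]^2 (S n), IsAdapted α β W f →
      ∃ D : Submodule ℂ (⋀[ℂ]^2 (S n)), IsInvariant α β D ∧ IsCompl D W ∧
        HasExactSeq (pairing n f)
          (D ⊓ LinearMap.ker (pairing n f) : Submodule ℂ (⋀[ℂ]^2 (S n))) W ∧
        (f ∉ W → f ∈ D ∧ HasExactSeq (pairing n f) (modLine D f) W) := by
  refine ⟨exists_isAdapted hβ hW, fun hlt f f' hf hf' => ?_, fun hlt f hf i j => ?_, fun f hf => ?_⟩
  · obtain ⟨φ, -, -, -, huniq⟩ := exists_special_form hlt hW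
    obtain ⟨c, hc, h⟩ := huniq f hf
    obtain ⟨c', hc', h'⟩ := huniq f' hf'
    refine ⟨c' * c⁻¹, mul_ne_zero hc' (inv_ne_zero hc), pairing_bijective.1 ?_⟩
    rw [map_smul, h, h', smul_smul, inv_mul_cancel_right₀ hc]
  · obtain ⟨φ, hφ, -, h0, huniq⟩ := exists_special_form hlt hW
    obtain ⟨c, hc, h⟩ := huniq f hf
    rw [h, LinearMap.smul_apply, smul_ne_zero_iff]
    exact ⟨fun h1 => by_contra fun h2 => h1.2 (hφ i j h2), fun h1 => ⟨hc, h0 i j h1⟩⟩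
  · obtain ⟨D, hD, hc, hfD⟩ := hf.exists_isInvariant_isCompl hβ hW.invariant
    have hω : W ≤ LinearMap.ker (pairing n f) := fun w hw => hf.orthogonal w hw
    refine ⟨D, hD, hc, hasExactSeq_of_equiv hf.pairing_ne_zero hf.nondegenerate hW.decomposable hω
      (kerEquiv hc hω), fun hfW => ⟨hfD hfW, ?_⟩⟩
    have hf0 : f ≠ 0 := by rintro rfl; exact hfW W.zero_mem
    -- `D / ℂ f` and the kernel of `f` on `D` have the same dimension
    exact hasExactSeq_of_equiv hf.pairing_ne_zero hf.nondegenerate hW.decomposable hω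
      (LinearEquiv.ofFinrankEq _ _ (finrank_modLine hc hω hf.pairing_ne_zero (hfD hfW) hf0))
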